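/- Let $X$ be a complex Banach space and let $A$ be the infinitesimal generator of a $C_0$-semigroup $T:[0,\infty)\to B(X)$; write $\sigma(A)$, $\rho(A)$ for its spectrum and resolvent set and $R(z,A)=(A-zI)^{-1}$ for $z\in\rho(A)$. Let $L^1_s(\mathbb R,B(X))$ be the set of $K:\mathbb R\to B(X)$ such that $s\mapsto K(s)v$ is (strongly) measurable for every $v\in X$ and $\|K(s)\|\le f(s)$ a.e. for some $f\in L^1(\mathbb R)$; $\|K\|_1$ is the infimum of $\|f\|_{L^1}$ over such $f$. Let $\mathcal F=\mathcal F(\mathbb R,X)$ be a homogeneous Banach function space, that is, a complex Banach space of (a.e. classes of) functions $\mathbb R\to X$ such that: (1) $\mathcal F$ is continuously embedded in the Stepanov space with norm $\sup_{t\in\mathbb R}\int_0^1\|x(s+t)\|\,ds$; (2) for $t\in\mathbb R$, $x\in\mathcal F$ the translate $x(t+\cdot)$ lies in $\mathcal F$ and has the same norm as $x$; (3) for $C\in B(X)$, $x\in\mathcal F$ the function $t\mapsto C(x(t))$ lies in $\mathcal F$ with norm at most $\|C\|\|x\|$; (4) for $K\in L^1_s(\mathbb R,B(X))$, $x\in\mathcal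 F$ the convolution $(K*x)(t)=\int_{\mathbb R}K(s)x(t-s)\,ds$ lies in $\mathcal F$ with norm at most $\|K\|_1\|x\|$; (5) if $x\in\mathcal F$ and $f*x=0$ for all $f\in L^1(\mathbb R)$, then $x=0$. For $f\in L^1(\mathbb R)$ put $\hat f(\lambda)=\int_{\mathbb R} f(t)e^{-it\lambda}\,dt$. The Beurling spectrum $\Lambda(x)$ of $x\in\mathcal F$ is the complement in $\mathbb R$ of the set of $\lambda$ for which there is $f\in L^1(\mathbb R)$ with $\hat f(\lambda)\neq0$ and $f*x=0$; for $\Delta\subset\mathbb R$ put $\mathcal F(\Delta)=\{x\in\mathcal F:\Lambda(x)\subseteq\Delta\}$. The operator $\mathscr L=-d/dt+A$ in $\mathcal F$ is defined as follows: $x\in D(\mathscr L)$ and $\mathscr Lx=y$ if $x,y\in\mathcal F$ and (for a representative of $x$) $$x(t)=T(t-s)x(s)-\int_s^tT(t-\tau)y(\tau)\,d\tau\qquad\text{for all } s\le t .$$ Denote by $\mathscr L_{\mathcal F(\Delta)}$ the operator defined in the same way with $x,y\in\mathcal F(\Delta)$. **Theorem.** Let $\Delta\subset\mathbb R$ be compact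 with $i\Delta\cap\sigma(A)=\emptyset$. Then $\mathscr Lx\in\mathcal F(\Delta)$ whenever $x\in D(\mathscr L)\cap\mathcal F(\Delta)$, so that $\mathscr L_{\mathcal F(\Delta)}$ is the restriction of $\mathscr L$ to $\mathcal F(\Delta)$, and $\mathscr L_{\mathcal F(\Delta)}$ is a (well-defined, i.e. single-valued) invertible operator: its kernel is $\{0\}$ and its range is $\mathcal F(\Delta)$. Moreover, there are functions $\varphi\in C^\infty(\mathbb R,\mathbb C)$ with compact support that equal $1$ in a neighbourhood of $\Delta$ and satisfy $i\operatorname{supp}\varphi\subset\rho(A)$; and for every such $\varphi$ the function $$F(t)=\frac1{2\pi}\int_{\mathbb R}\varphi(\lambda)R(i\lambda,A)e^{i\lambda t}\,d\lambda$$ belongs to $L^1(\mathbb R,B(X))$ and, for every $y\in\mathcal F(\Delta)$, the function $F*y$ belongs to $D(\mathscr L_{\mathcal F(\Delta)})$ and $\mathscr L_{\mathcal F(\Delta)}(F*y)=y$. -/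

import Mathlib

open MeasureTheory Filter Topology
open scoped NNReal ENNReal ContDiff

noncomputable section

/-- A `C₀`-semigroup `T : [0, ∞) → B(X)` of bounded operators on `X`. -/
structure C0Semigroup (X : Type*) [NormedAddCommGroup X] [NormedSpace ℂ X] where
  /-- the operators of the semigroup -/
  op : ℝ≥0 → X →L[ℂ] X
  op_zero : op 0 = ContinuousLinearMap.id ℂ X
  op_add : ∀ s t, op (s + t) = (op s).comp (op t)
  continuous_op : ∀ v : X, Continuous fun t => op t v

namespace C0Semigroup

variable {X : Type*} [NormedAddCommGroup X] [NormedSpace ℂ X]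

/-- `w` is the limit of the difference quotients `(T(h)v - v)/h` as `h → 0+`. -/
def HasDerivZero (T : C0Semigroup X) (v w : X) : Prop :=
  Tendsto (fun h : ℝ≥0 => (((h : ℝ) : ℂ))⁻¹ • (T.op h v - v)) (𝓝[>] 0) (𝓝 w)

theorem HasDerivZero.unique {T : C0Semigroup X} {v w w' : X}
    (h : T.HasDerivZero v w) (h' : T.HasDerivZero v w') : w = w' :=
  tendsto_nhds_unique h h'

theorem HasDerivZero.add {T : C0Semigroup X} {v w v' w' : X}
    (h : T.HasDerivZero v w) (h' : T.HasDerivZero v' w') :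
    T.HasDerivZero (v + v') (w + w') := by
  refine (Tendsto.add h h').congr fun a => ?_
  rw [← smul_add, map_add]
  congr 1
  abel

theorem HasDerivZero.smul {T : C0Semigroup X} {v w : X} (c : ℂ)
    (h : T.HasDerivZero v w) : T.HasDerivZero (c • v) (c • w) := by
  refine (Tendsto.const_smul h c).congr fun a => ?_
  rw [smul_comm, smul_sub, map_smul]

theorem HasDerivZero.zero (T : C0Semigroup X) : T.HasDerivZero 0 0 := by
  simp [HasDerivZero]

/-- The infinitesimal generator `A` of the semigroup, with its maximal domain: the vectors `v`
for which `(T(h)v - v)/h` converges as `h → 0+`; `A v` is the limit. -/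
def generator (T : C0Semigroup X) : X →ₗ.[ℂ] X where
  domain :=
    { carrier := {v | ∃ w, T.HasDerivZero v w}
      add_mem' := fun ⟨w, hw⟩ ⟨w', hw'⟩ => ⟨w + w', hw.add hw'⟩
      zero_mem' := ⟨0, HasDerivZero.zero T⟩
      smul_mem' := fun c _ ⟨w, hw⟩ => ⟨c • w, hw.smul c⟩ }
  toFun :=
    { toFun := fun v => Classical.choose v.2
      map_add' := fun v v' => (Classical.choose_spec (v + v').2).unique
        ((Classical.choose_spec v.2).add (Classical.choose_spec v'.2))
      map_smul' := fun c v => (Classical.choose_spec (c • v).2).unique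
        ((Classical.choose_spec v.2).smul c) }

end C0Semigroup

section Resolvent

variable {X : Type*} [NormedAddCommGroup X] [NormedSpace ℂ X]

/-- The bounded operator `R` is the two-sided inverse of `A - z I : D(A) → X`. -/
def IsResolventAt (A : X →ₗ.[ℂ] X) (z : ℂ) (R : X →L[ℂ] X) : Prop :=
  (∀ v : X, ∃ h : R v ∈ A.domain, A ⟨R v, h⟩ - z • R v = v) ∧
    ∀ v : A.domain, R (A v - z • (v : X)) = v

/-- The resolvent set `ρ(A)` of an unbounded operator. -/
def unboundedResolventSet (A : X →ₗ.[ℂ] X) : Set ℂ :=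
  {z | ∃ R : X →L[ℂ] X, IsResolventAt A z R}

/-- The spectrum `σ(A)` of an unbounded operator. -/
def unboundedSpectrum (A : X →ₗ.[ℂ] X) : Set ℂ := (unboundedResolventSet A)ᶜ

open Classical in
/-- The resolvent `R(z, A) = (A - z I)⁻¹` for `z ∈ ρ(A)` (and `0` for `z ∈ σ(A)`). -/
def unboundedResolvent (A : X →ₗ.[ℂ] X) (z : ℂ) : X →L[ℂ] X :=
  if h : ∃ R : X →L[ℂ] X, IsResolventAt A z R then Classical.choose h else 0

end Resolvent

section Convolution

variable {X : Type*} [NormedAddCommGroup X] [NormedSpace ℂ X]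

/-- Fourier transform `∫ f(t) exp(-i t l) dt` of a scalar function. -/
def scalarFourier (f : ℝ → ℂ) (l : ℝ) : ℂ :=
  ∫ t : ℝ, f t * Complex.exp (-(Complex.I * t * l))

/-- `(f * x)(t) = ∫ f(s) x(t - s) ds` for a scalar function `f`. -/
def scalarConv (f : ℝ → ℂ) (x : ℝ → X) (t : ℝ) : X := ∫ s : ℝ, f s • x (t - s)

/-- `(K * x)(t) = ∫ K(s) x(t - s) ds` for an operator-valued function `K`. -/
def opConv (K : ℝ → X →L[ℂ] X) (x : ℝ → X) (t : ℝ) : X := ∫ s : ℝ, K s (x (t - s))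

/-- `f` is an integrable majorant of the operator norm of `K`. -/
def IsMajorant (K : ℝ → X →L[ℂ] X) (f : ℝ → ℝ) : Prop :=
  Integrable f ∧ ∀ᵐ s : ℝ, ‖K s‖ ≤ f s

/-- Membership in `L¹ₛ(ℝ, B(X))`: strongly measurable along each vector, and with an
integrable majorant of the operator norm. -/
def MemL1s (K : ℝ → X →L[ℂ] X) : Prop :=
  (∀ v : X, AEStronglyMeasurable (fun s => K s v) volume) ∧ ∃ f : ℝ → ℝ, IsMajorant K f

/-- The norm of `L¹ₛ(ℝ, B(X))`: the infimum of the `L¹` norms of the majorants. -/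
def normL1s (K : ℝ → X →L[ℂ] X) : ℝ :=
  sInf {c | ∃ f : ℝ → ℝ, IsMajorant K f ∧ c = ∫ s : ℝ, ‖f s‖}

end Convolution

/-- A homogeneous Banach function space `F(ℝ, X)`. The Banach space is `E` (completeness is an
instance argument where the structure is used); `toAE` realizes its elements as classes of
functions `ℝ → X` up to equality almost everywhere. -/
structure HomogeneousSpace (X E : Type*) [NormedAddCommGroup X] [NormedSpace ℂ X]
    [NormedAddCommGroup E] [NormedSpace ℂ E] where
  /-- an element of the space, as a class of functions -/
  toAE : E →ₗ[ℂ] (ℝ →ₘ[volume] X)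
  toAE_injective : Function.Injective toAE
  /-- `E` is continuously embedded into the Stepanov space `S¹` -/
  stepanov_bound : ∃ C : ℝ, ∀ (x : E) (t : ℝ),
    ∫⁻ s in Set.Icc (0 : ℝ) 1, ‖toAE x (s + t)‖ₑ ≤ ENNReal.ofReal (C * ‖x‖)
  /-- translations act isometrically -/
  translation : ∀ (t : ℝ) (x : E), ∃ y : E,
    (∀ᵐ s : ℝ, toAE y s = toAE x (t + s)) ∧ ‖y‖ = ‖x‖
  /-- bounded operators act pointwise -/
  pointwise : ∀ (C : X →L[ℂ] X) (x : E), ∃ y : E,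
    (∀ᵐ s : ℝ, toAE y s = C (toAE x s)) ∧ ‖y‖ ≤ ‖C‖ * ‖x‖
  /-- `L¹ₛ(ℝ, B(X))` acts by convolution -/
  convolution : ∀ (K : ℝ → X →L[ℂ] X), MemL1s K → ∀ x : E, ∃ y : E,
    (∀ᵐ t : ℝ, toAE y t = opConv K (toAE x) t) ∧ ‖y‖ ≤ normL1s K * ‖x‖
  /-- the convolution action of `L¹(ℝ)` is non-degenerate -/
  nondegenerate : ∀ x : E,
    (∀ f : ℝ → ℂ, Integrable f → ∀ᵐ t : ℝ, scalarConv f (toAE x) t = 0) → x = 0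

namespace HomogeneousSpace

variable {X E : Type*} [NormedAddCommGroup X] [NormedSpace ℂ X]
  [NormedAddCommGroup E] [NormedSpace ℂ E]

/-- The Beurling spectrum of `x`: its complement consists of the `l` for which some
`f ∈ L¹(ℝ)` has nonzero Fourier transform at `l` and satisfies `f * x = 0`. -/
def beurlingSpectrum (F : HomogeneousSpace X E) (x : E) : Set ℝ :=
  {l | ∃ f : ℝ → ℂ, Integrable f ∧ scalarFourier f l ≠ 0 ∧
    ∀ᵐ t : ℝ, scalarConv f (F.toAE x) t = 0}ᶜ

/-- The spectral submodule `F(Δ)`: the elements with Beurling spectrum inside `Δ`. -/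
def spectralSubmodule (F : HomogeneousSpace X E) (Δ : Set ℝ) : Set E :=
  {x | F.beurlingSpectrum x ⊆ Δ}

/-- The graph of the parabolic operator `𝓛 = -d/dt + A`: `𝓛 x = y` when (the necessarily unique
and continuous representative `u` of) `x` satisfies
`u(t) = T(t-s) u(s) - ∫_s^t T(t-τ) y(τ) dτ` for all `s ≤ t`. -/
def ParabolicGraph (F : HomogeneousSpace X E) (T : C0Semigroup X) (x y : E) : Prop :=
  ∃ u : ℝ → X, (∀ᵐ t : ℝ, u t = F.toAE x t) ∧ ∀ s t : ℝ, s ≤ t →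
    u t = T.op (t - s).toNNReal (u s) -
      ∫ τ in s..t, T.op (t - τ).toNNReal (F.toAE y τ)

/-- The graph of the operator `𝓛` in the space `M ⊆ F(ℝ, X)`: both `x` and `𝓛 x` lie in `M`. -/
def ParabolicGraphIn (F : HomogeneousSpace X E) (T : C0Semigroup X) (M : Set E)
    (x y : E) : Prop :=
  x ∈ M ∧ y ∈ M ∧ F.ParabolicGraph T x y

end HomogeneousSpace

/-- `G` is the graph of a (partially defined, linear) operator in `M` that is invertible:
single-valued, with kernel `{0}` and with range `M`. -/
structure IsInvertibleGraph {E : Type*} [Zero E] (G : E → E → Prop) (M : Set E) : Prop where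
  single_valued : ∀ x y y', G x y → G x y' → y = y'
  ker_eq : {x | G x 0} = {0}
  range_eq : {y | ∃ x, G x y} = M

section Kernel

variable {X : Type*} [NormedAddCommGroup X] [NormedSpace ℂ X]

/-- A smooth compactly supported function `φ` that equals `1` in a neighbourhood of `Δ` and has
`i supp φ` inside the resolvent set of `A`. -/
structure IsSpectralCutoff (A : X →ₗ.[ℂ] X) (Δ : Set ℝ) (φ : ℝ → ℂ) : Prop where
  smooth : ContDiff ℝ ∞ φ
  compact_support : HasCompactSupport φ
  eq_one : ∃ U : Set ℝ, IsOpen U ∧ Δ ⊆ U ∧ ∀ l ∈ U, φ l = 1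
  support_resolvent : ∀ l ∈ tsupport φ, Complex.I * (l : ℂ) ∈ unboundedResolventSet A

/-- The inverse Fourier transform `(1/2π) ∫ φ(l) R(il, A) exp(i l t) dl`. -/
def resolventKernel (A : X →ₗ.[ℂ] X) (φ : ℝ → ℂ) (t : ℝ) : X →L[ℂ] X :=
  ((2 * Real.pi : ℝ) : ℂ)⁻¹ • ∫ l : ℝ,
    (φ l * Complex.exp (Complex.I * l * t)) • unboundedResolvent A (Complex.I * l)

end Kernel

end

/-!
On `𝓕(Δ)` the operator `𝓛` is inverted by convolution with the resolvent kernel `F`.  Integrating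
the mild solutions `exp(ilt) R(il, A) v` against `φ(l) dl` shows that `F * y` is a mild solution
with right-hand side `ψ * y`, where `ψ` is the inverse Fourier transform of `φ`; and `ψ * y = y`
for `y ∈ 𝓕(Δ)`, because `φ = 1` near the Beurling spectrum of `y`.  Conversely, convolution with an
integrable kernel that commutes with the semigroup preserves mild solutions.  With scalar kernels
this gives `Λ(𝓛 x) ⊆ Λ(x)`; with the kernel `F` it gives the injectivity of `𝓛` on `𝓕(Δ)`, since
`𝓛 x = 0` then implies `x = ψ * x = 𝓛 (F * x) = F * 𝓛 x = 0`.
-/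

namespace C0Semigroup

variable {X : Type*} [NormedAddCommGroup X] [NormedSpace ℂ X]

theorem op_toNNReal_add (T : C0Semigroup X) {s t : ℝ} (hs : 0 ≤ s) (ht : 0 ≤ t) (v : X) :
    T.op (s + t).toNNReal v = T.op s.toNNReal (T.op t.toNNReal v) := by
  rw [Real.toNNReal_add hs ht, T.op_add, ContinuousLinearMap.comp_apply]

theorem op_toNNReal_zero (T : C0Semigroup X) (v : X) : T.op (0 : ℝ).toNNReal v = v := by
  simp [T.op_zero]

theorem op_comm (T : C0Semigroup X) (s t : ℝ≥0) (v : X) :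
    T.op s (T.op t v) = T.op t (T.op s v) := by
  rw [← ContinuousLinearMap.comp_apply, ← T.op_add, add_comm, T.op_add,
    ContinuousLinearMap.comp_apply]

theorem continuous_op_toNNReal (T : C0Semigroup X) (v : X) :
    Continuous fun t : ℝ => T.op t.toNNReal v :=
  (T.continuous_op v).comp continuous_real_toNNReal

theorem hasDerivZero_generator (T : C0Semigroup X) (v : T.generator.domain) :
    T.HasDerivZero (v : X) (T.generator v) :=
  Classical.choose_spec v.2

theorem HasDerivZero.generator_eq {T : C0Semigroup X} {v w : X} (h : T.HasDerivZero v w) :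
    T.generator ⟨v, w, h⟩ = w :=
  (T.hasDerivZero_generator ⟨v, w, h⟩).unique h

theorem HasDerivZero.map_op {T : C0Semigroup X} {v w : X} (h : T.HasDerivZero v w) (t : ℝ≥0) :
    T.HasDerivZero (T.op t v) (T.op t w) := by
  refine (((T.op t).continuous.tendsto w).comp h).congr fun a => ?_
  rw [Function.comp_apply, map_smul, map_sub, T.op_comm]

theorem HasDerivZero.hasDerivWithinAt {T : C0Semigroup X} {v w : X} (h : T.HasDerivZero v w)
    {t : ℝ} (ht : 0 ≤ t) :
    HasDerivWithinAt (fun r : ℝ => T.op r.toNNReal v) (T.op t.toNNReal w) (Set.Ioi t) t := by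
  rw [hasDerivWithinAt_iff_tendsto_slope' (by simp)]
  have hshift : Tendsto (fun r : ℝ => (r - t).toNNReal) (𝓝[>] t) (𝓝[>] 0) := by
    have hc : Continuous fun r : ℝ => (r - t).toNNReal := by fun_prop
    refine tendsto_nhdsWithin_iff.2 ⟨?_, ?_⟩
    · simpa using (hc.tendsto t).mono_left nhdsWithin_le_nhds
    · filter_upwards [self_mem_nhdsWithin] with r hr
      simpa using hr
  refine ((h.map_op t.toNNReal).comp hshift).congr' ?_
  filter_upwards [self_mem_nhdsWithin] with r hr
  have hr' : 0 ≤ r - t := sub_nonneg.2 (le_of_lt hr)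
  rw [Function.comp_apply, slope_def_module, ← T.op_toNNReal_add hr' ht, sub_add_cancel,
    Real.coe_toNNReal _ hr', ← Complex.ofReal_inv, Complex.coe_smul]

variable [CompleteSpace X]

theorem exists_norm_op_le (T : C0Semigroup X) (b : ℝ≥0) : ∃ M : ℝ, ∀ t ≤ b, ‖T.op t‖ ≤ M := by
  have hptwise : ∀ v : X, ∃ C, ∀ t : Set.Icc (0 : ℝ≥0) b, ‖T.op t v‖ ≤ C := fun v => by
    obtain ⟨C, hC⟩ := (isCompact_Icc (a := (0 : ℝ≥0)) (b := b)).exists_bound_of_continuousOn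
      (T.continuous_op v).continuousOn
    exact ⟨C, fun t => hC t t.2⟩
  obtain ⟨M, hM⟩ := banach_steinhaus hptwise
  exact ⟨M, fun t ht => hM ⟨t, zero_le, ht⟩⟩

theorem exists_enorm_op_le (T : C0Semigroup X) (b : ℝ) :
    ∃ M : ℝ≥0∞, M ≠ ⊤ ∧ ∀ t ≤ b, ∀ v : X, ‖T.op t.toNNReal v‖ₑ ≤ M * ‖v‖ₑ := by
  obtain ⟨M, hM⟩ := T.exists_norm_op_le b.toNNReal
  refine ⟨ENNReal.ofReal M, ENNReal.ofReal_ne_top, fun t ht v => ((T.op _).le_opENorm v).trans ?_⟩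
  gcongr
  rw [← ofReal_norm]
  exact ENNReal.ofReal_le_ofReal (hM _ (Real.toNNReal_le_toNNReal ht))

theorem continuous_uncurry_op (T : C0Semigroup X) :
    Continuous fun p : ℝ≥0 × X => T.op p.1 p.2 := by
  refine continuous_iff_continuousAt.2 fun ⟨t₀, v₀⟩ => ?_
  obtain ⟨M, hM⟩ := T.exists_norm_op_le (t₀ + 1)
  have hvec : Tendsto (fun p : ℝ≥0 × X => T.op p.1 (p.2 - v₀)) (𝓝 (t₀, v₀)) (𝓝 0) := by
    refine squeeze_zero_norm' (a := fun p : ℝ≥0 × X => M * ‖p.2 - v₀‖) ?_ ?_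
    · have : ∀ᶠ p : ℝ≥0 × X in 𝓝 (t₀, v₀), p.1 < t₀ + 1 :=
        continuous_fst.continuousAt.eventually_lt_const (by simp)
      filter_upwards [this] with p hp
      exact (T.op p.1).le_of_opNorm_le (hM _ hp.le) _
    · have : Continuous fun p : ℝ≥0 × X => M * ‖p.2 - v₀‖ := by fun_prop
      simpa using this.tendsto (t₀, v₀)
  have htime : Tendsto (fun p : ℝ≥0 × X => T.op p.1 v₀) (𝓝 (t₀, v₀)) (𝓝 (T.op t₀ v₀)) :=
    ((T.continuous_op v₀).comp continuous_fst).tendsto (t₀, v₀)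
  simpa [ContinuousAt] using hvec.add htime

theorem aestronglyMeasurable_op {α : Type*} [MeasurableSpace α] {μ : Measure α}
    (T : C0Semigroup X) {h : α → ℝ} (hh : Measurable h) {g : α → X}
    (hg : AEStronglyMeasurable g μ) :
    AEStronglyMeasurable (fun a => T.op (h a).toNNReal (g a)) μ :=
  T.continuous_uncurry_op.comp_aestronglyMeasurable
    (hh.real_toNNReal.stronglyMeasurable.aestronglyMeasurable.prodMk hg)

theorem integrable_op {α : Type*} [MeasurableSpace α] {μ : Measure α} (T : C0Semigroup X)
    {h : α → ℝ} (hh : Measurable h) {b : ℝ} (hb : ∀ᵐ a ∂μ, h a ≤ b) {g : α → X}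
    (hg : Integrable g μ) : Integrable (fun a => T.op (h a).toNNReal (g a)) μ := by
  obtain ⟨M, hM⟩ := T.exists_norm_op_le b.toNNReal
  refine (hg.norm.const_mul M).mono' (T.aestronglyMeasurable_op hh hg.1) ?_
  filter_upwards [hb] with a ha
  exact (T.op _).le_of_opNorm_le (hM _ (Real.toNNReal_le_toNNReal ha)) _

theorem locallyIntegrable_op (T : C0Semigroup X) {y : ℝ → X} (hy : LocallyIntegrable y) (q : ℝ) :
    LocallyIntegrable fun τ => T.op (q - τ).toNNReal (y τ) :=
  locallyIntegrable_iff.2 fun K hK => by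
    obtain ⟨a, ha⟩ := hK.bddBelow
    refine T.integrable_op (b := q - a) (by fun_prop) ?_ (hy.integrableOn_isCompact hK)
    filter_upwards [ae_restrict_mem hK.measurableSet] with τ hτ
    exact sub_le_sub_left (ha hτ) q

end C0Semigroup

section Resolvent

variable {X : Type*} [NormedAddCommGroup X] [NormedSpace ℂ X]

theorem IsResolventAt.unique {A : X →ₗ.[ℂ] X} {z : ℂ} {R R' : X →L[ℂ] X}
    (h : IsResolventAt A z R) (h' : IsResolventAt A z R') : R = R' := by
  ext v
  obtain ⟨hv, hAv⟩ := h.1 v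
  have := h'.2 ⟨R v, hv⟩
  rw [hAv] at this
  exact this.symm

theorem isResolventAt_unboundedResolvent {A : X →ₗ.[ℂ] X} {z : ℂ}
    (hz : z ∈ unboundedResolventSet A) : IsResolventAt A z (unboundedResolvent A z) := by
  rw [unboundedResolvent, dif_pos (show ∃ R : X →L[ℂ] X, IsResolventAt A z R from hz)]
  exact Classical.choose_spec hz

-- On the domain of `A`, the operator `1 - (w - z) R` is `R (A - w)`.
theorem IsResolventAt.mul_ringInverse {A : X →ₗ.[ℂ] X} {z : ℂ} {R : X →L[ℂ] X}
    (h : IsResolventAt A z R) {w : ℂ} (hu : IsUnit (1 - (w - z) • R)) :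
    IsResolventAt A w (R * Ring.inverse (1 - (w - z) • R)) := by
  obtain ⟨u, hu⟩ := hu
  have hu_apply (v : X) : (u : X →L[ℂ] X) v = v - (w - z) • R v := by
    rw [hu, sub_apply, one_apply_eq_self, smul_apply]
  have hcomm : R * (↑u⁻¹ : X →L[ℂ] X) = ↑u⁻¹ * R := by
    have : Commute R u := hu ▸ (Commute.one_right R).sub_right ((Commute.refl R).smul_right _)
    exact this.units_inv_right.eq
  rw [← hu, Ring.inverse_unit]
  constructor
  · intro v
    obtain ⟨y, rfl⟩ : ∃ y, (u : X →L[ℂ] X) y = v :=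
      ⟨(↑u⁻¹ : X →L[ℂ] X) v, by rw [← mul_apply_eq_comp, Units.mul_inv, one_apply_eq_self]⟩
    obtain ⟨hd, hAy⟩ := h.1 y
    have hRy : (R * (↑u⁻¹ : X →L[ℂ] X)) ((u : X →L[ℂ] X) y) = R y := by
      rw [← mul_apply_eq_comp, mul_assoc, Units.inv_mul, mul_one]
    simp only [hRy]
    refine ⟨hd, ?_⟩
    change A ⟨R y, hd⟩ - w • R y = (u : X →L[ℂ] X) y
    rw [hu_apply, sub_smul, sub_eq_iff_eq_add.1 hAy]
    abel
  · intro v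
    have hRA : R (A v - w • (v : X)) = (u : X →L[ℂ] X) v := by
      have hsplit : A v - w • (v : X) = (A v - z • (v : X)) - (w - z) • (v : X) := by
        rw [sub_smul]; abel
      rw [hsplit, map_sub, h.2 v, map_smul, hu_apply]
    rw [hcomm, mul_apply_eq_comp, hRA, ← mul_apply_eq_comp, Units.inv_mul, one_apply_eq_self]

variable [CompleteSpace X]

theorem eventually_isUnit_one_sub_smul (z : ℂ) (R : X →L[ℂ] X) :
    ∀ᶠ w in 𝓝 z, IsUnit (1 - (w - z) • R) := by
  have hc : Continuous fun w : ℂ => (1 : X →L[ℂ] X) - (w - z) • R := by fun_prop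
  exact hc.continuousAt.eventually (Units.isOpen.mem_nhds (by simp))

theorem isOpen_unboundedResolventSet (A : X →ₗ.[ℂ] X) : IsOpen (unboundedResolventSet A) := by
  refine isOpen_iff_mem_nhds.2 fun z ⟨R, hR⟩ => ?_
  filter_upwards [eventually_isUnit_one_sub_smul z R] with w hw
  exact ⟨_, hR.mul_ringInverse hw⟩

theorem contDiffAt_unboundedResolvent {A : X →ₗ.[ℂ] X} {z : ℂ}
    (hz : z ∈ unboundedResolventSet A) : ContDiffAt ℂ ∞ (unboundedResolvent A) z := by
  obtain ⟨R, hR⟩ := hz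
  have hinv : ContDiffAt ℂ ∞ Ring.inverse ((1 : X →L[ℂ] X) - (z - z) • R) := by
    simpa using contDiffAt_ringInverse ℂ (1 : (X →L[ℂ] X)ˣ)
  have hlin : ContDiffAt ℂ ∞ (fun w : ℂ => (1 : X →L[ℂ] X) - (w - z) • R) z := by fun_prop
  have hformula : ContDiffAt ℂ ∞ (fun w : ℂ => R * Ring.inverse (1 - (w - z) • R)) z :=
    contDiffAt_const.mul (ContDiffAt.comp z (g := Ring.inverse) hinv hlin)
  refine hformula.congr_of_eventuallyEq ?_
  filter_upwards [eventually_isUnit_one_sub_smul z R] with w hw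
  have hRw := hR.mul_ringInverse hw
  exact (isResolventAt_unboundedResolvent ⟨_, hRw⟩).unique hRw

end Resolvent

theorem intervalIntegrable_of_locallyIntegrable {X : Type*} [NormedAddCommGroup X] {f : ℝ → X}
    (hf : LocallyIntegrable f) (a b : ℝ) : IntervalIntegrable f volume a b :=
  intervalIntegrable_iff.2
    ((hf.integrableOn_isCompact isCompact_uIcc).mono_set Set.uIoc_subset_uIcc)

theorem ae_lt_imp_eq_zero_of_integral_eq_zero {X : Type*} [NormedAddCommGroup X]
    [NormedSpace ℝ X] [CompleteSpace X] {f : ℝ → X} (hf : LocallyIntegrable f) {D : Set ℝ}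
    (hD : Dense D) {q : ℝ} (h : ∀ s ∈ D, s < q → ∫ τ in s..q, f τ = 0) :
    ∀ᵐ τ, τ < q → f τ = 0 := by
  have hzero : Set.Iio q ⊆ {s | ∫ τ in q..s, f τ = 0} := by
    refine (hD.open_subset_closure_inter isOpen_Iio).trans (closure_minimal (fun s hs => ?_)
      (isClosed_eq (intervalIntegral.continuous_primitive
        (intervalIntegrable_of_locallyIntegrable hf) q) continuous_const))
    rw [Set.mem_ofPred_eq, intervalIntegral.integral_symm, h s hs.2 hs.1, neg_zero]
  filter_upwards [LocallyIntegrable.ae_hasDerivAt_integral hf] with τ hτ hlt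
  refine (hτ q).unique ((hasDerivAt_const τ (0 : X)).congr_of_eventuallyEq ?_)
  filter_upwards [Iio_mem_nhds hlt] with s hs using hzero hs

namespace C0Semigroup

variable {X : Type*} [NormedAddCommGroup X] [NormedSpace ℂ X]

/-- `u` is a mild solution of the inhomogeneous Cauchy problem `u' = A u - y` on the whole line,
where `A` generates `T`. The variation of constants formula is required at every pair of times;
`y` matters only up to equality almost everywhere. -/
def IsMildSolution (T : C0Semigroup X) (u y : ℝ → X) : Prop :=
  ∀ s t : ℝ, s ≤ t →
    u t = T.op (t - s).toNNReal (u s) - ∫ τ in s..t, T.op (t - τ).toNNReal (y τ)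

namespace IsMildSolution

variable {T : C0Semigroup X} {u y : ℝ → X}

theorem zero : T.IsMildSolution 0 0 := fun s t _ => by simp

theorem congr_ae {y' : ℝ → X} (h : T.IsMildSolution u y) (hy : y =ᵐ[volume] y') :
    T.IsMildSolution u y' := fun s t hst => by
  rw [h s t hst]
  congr 1
  refine intervalIntegral.integral_congr_ae ?_
  filter_upwards [hy] with τ hτ _
  rw [hτ]

theorem const_smul (h : T.IsMildSolution u y) (c : ℂ) :
    T.IsMildSolution (fun t => c • u t) (fun t => c • y t) := fun s t hst => by
  simp only [map_smul, intervalIntegral.integral_smul]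
  rw [← smul_sub, ← h s t hst]

theorem comp_sub_right (h : T.IsMildSolution u y) (r : ℝ) :
    T.IsMildSolution (fun t => u (t - r)) (fun t => y (t - r)) := fun s t hst => by
  have hshift := intervalIntegral.integral_comp_sub_right
    (fun τ => T.op (t - r - τ).toNNReal (y τ)) r (a := s) (b := t)
  have huts := h (s - r) (t - r) (by linarith)
  simp only [sub_sub_sub_cancel_right] at hshift huts
  rwa [← hshift] at huts

variable [CompleteSpace X]

theorem map (h : T.IsMildSolution u y) (hy : LocallyIntegrable y) {C : X →L[ℂ] X}
    (hC : ∀ a v, C (T.op a v) = T.op a (C v)) :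
    T.IsMildSolution (fun t => C (u t)) (fun t => C (y t)) := fun s t hst => by
  simp only [h s t hst, map_sub, hC, ← C.intervalIntegral_comp_comm
    (intervalIntegrable_of_locallyIntegrable (T.locallyIntegrable_op hy t) s t)]

theorem integral {α : Type*} [MeasurableSpace α] {μ : Measure α} [SFinite μ]
    {u f : α → ℝ → X}
    (h : ∀ r, T.IsMildSolution (u r) (f r)) (hu : ∀ t, Integrable (fun r => u r t) μ)
    (hf : ∀ s t, Integrable (fun p : ℝ × α => f p.2 p.1)
      ((volume.restrict (Set.Ioc s t)).prod μ)) :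
    T.IsMildSolution (fun t => ∫ r, u r t ∂μ) (fun t => ∫ r, f r t ∂μ) := by
  intro s t hst
  have hTf : Integrable (Function.uncurry fun τ r => T.op (t - τ).toNNReal (f r τ))
      ((volume.restrict (Set.Ioc s t)).prod μ) := by
    refine T.integrable_op (h := fun p => t - p.1) (b := t - s) (by fun_prop) ?_ (hf s t)
    filter_upwards [Measure.quasiMeasurePreserving_fst.ae
      (ae_restrict_mem measurableSet_Ioc)] with p hp
    linarith [hp.1]
  have hTf_int : Integrable (fun r => ∫ τ in Set.Ioc s t, T.op (t - τ).toNNReal (f r τ)) μ :=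
    hTf.integral_prod_right
  calc ∫ r, u r t ∂μ
      = ∫ r, (T.op (t - s).toNNReal (u r s) -
          ∫ τ in Set.Ioc s t, T.op (t - τ).toNNReal (f r τ)) ∂μ := integral_congr_ae <|
        ae_of_all _ fun r => by simp only [← intervalIntegral.integral_of_le hst, ← h r s t hst]
    _ = T.op (t - s).toNNReal (∫ r, u r s ∂μ) -
          ∫ r, (∫ τ in Set.Ioc s t, T.op (t - τ).toNNReal (f r τ)) ∂μ := by
        rw [integral_sub ((T.op _).integrable_comp (hu s)) hTf_int,
          (T.op _).integral_comp_comm (hu s)]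
    _ = T.op (t - s).toNNReal (∫ r, u r s ∂μ) -
          ∫ τ in s..t, T.op (t - τ).toNNReal (∫ r, f r τ ∂μ) := by
        rw [← integral_integral_swap hTf, intervalIntegral.integral_of_le hst]
        congr 1
        refine integral_congr_ae ?_
        filter_upwards [(hf s t).prod_right_ae] with τ hτ
        exact (T.op _).integral_comp_comm hτ

end IsMildSolution

variable {T : C0Semigroup X} [CompleteSpace X] {y : ℝ → X}

theorem ae_eq_zero_of_integral_op (hy : LocallyIntegrable y) {G : Set ℝ} (hG : ∀ᵐ t, t ∈ G)
    (h : ∀ s ∈ G, ∀ t ∈ G, s ≤ t → ∫ τ in s..t, T.op (t - τ).toNNReal (y τ) = 0) :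
    y =ᵐ[volume] 0 := by
  have hdense : Dense G := Measure.dense_of_ae hG
  have hevol : ∀ q ∈ G, ∀ᵐ τ, τ < q → T.op (q - τ).toNNReal (y τ) = 0 := fun q hq =>
    ae_lt_imp_eq_zero_of_integral_eq_zero (T.locallyIntegrable_op hy q) hdense
      fun s hs hsq => h s hs q hq hsq.le
  obtain ⟨D, hDG, hDc, hDd⟩ := hdense.exists_countable_dense_subset
  have hevol_D : ∀ᵐ τ, ∀ q ∈ D, τ < q → T.op (q - τ).toNNReal (y τ) = 0 :=
    (ae_ball_iff hDc).2 fun q hq => hevol q (hDG hq)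
  filter_upwards [hevol_D] with τ hτ
  have hclosed : IsClosed {q | T.op (q - τ).toNNReal (y τ) = 0} :=
    isClosed_eq ((T.continuous_op_toNNReal (y τ)).comp (by fun_prop)) continuous_const
  have hIoi : Set.Ioi τ ⊆ {q | T.op (q - τ).toNNReal (y τ) = 0} :=
    (hDd.open_subset_closure_inter isOpen_Ioi).trans
      (closure_minimal (fun q hq => hτ q hq.2 hq.1) hclosed)
  have hτ_mem : τ ∈ closure (Set.Ioi τ) := by rw [closure_Ioi]; exact Set.self_mem_Ici
  have := closure_minimal hIoi hclosed hτ_mem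
  rwa [Set.mem_ofPred_eq, sub_self, T.op_toNNReal_zero] at this

theorem IsMildSolution.inhomogeneity_unique {u u' y' : ℝ → X} (h : T.IsMildSolution u y)
    (h' : T.IsMildSolution u' y') (hu : u =ᵐ[volume] u') (hy : LocallyIntegrable y)
    (hy' : LocallyIntegrable y') : y =ᵐ[volume] y' := by
  refine (sub_ae_eq_zero _ _).1 (ae_eq_zero_of_integral_op (T := T) (hy.sub hy') hu ?_)
  intro s (hs : u s = u' s) t (ht : u t = u' t) hst
  have hdiff := h s t hst
  rw [hs, ht, h' s t hst] at hdiff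
  simp only [Pi.sub_apply, map_sub]
  rw [intervalIntegral.integral_sub
    (intervalIntegrable_of_locallyIntegrable (T.locallyIntegrable_op hy t) s t)
    (intervalIntegrable_of_locallyIntegrable (T.locallyIntegrable_op hy' t) s t),
    sub_right_inj.1 hdiff, sub_self]

end C0Semigroup

namespace IsResolventAt

variable {X : Type*} [NormedAddCommGroup X] [NormedSpace ℂ X] {T : C0Semigroup X} {z : ℂ}
  {R : X →L[ℂ] X}

theorem map_op (hR : IsResolventAt T.generator z R) (t : ℝ≥0) (v : X) :
    R (T.op t v) = T.op t (R v) := by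
  obtain ⟨hd, hAR⟩ := hR.1 v
  have horbit := (T.hasDerivZero_generator ⟨R v, hd⟩).map_op t
  have := hR.2 ⟨T.op t (R v), _, horbit⟩
  simp only [horbit.generator_eq] at this
  rwa [← map_smul, ← map_sub, hAR] at this

theorem hasDerivWithinAt_exp_smul_op (hR : IsResolventAt T.generator z R) (v : X) {r : ℝ}
    (hr : 0 ≤ r) :
    HasDerivWithinAt (fun r : ℝ => Complex.exp (-(z * r)) • T.op r.toNNReal (R v))
      (Complex.exp (-(z * r)) • T.op r.toNNReal v) (Set.Ioi r) r := by
  obtain ⟨hd, hAR⟩ := hR.1 v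
  have hexp : HasDerivAt (fun r : ℝ => Complex.exp (-(z * r)))
      (Complex.exp (-(z * r)) * -z) r := by
    simpa using ((hasDerivAt_id r).ofReal_comp.const_mul z).fun_neg.cexp
  refine (hexp.hasDerivWithinAt.smul
    ((T.hasDerivZero_generator ⟨R v, hd⟩).hasDerivWithinAt hr)).congr_deriv ?_
  have hTv : T.op r.toNNReal v =
      T.op r.toNNReal (T.generator ⟨R v, hd⟩) - z • T.op r.toNNReal (R v) := by
    rw [← map_smul, ← map_sub, hAR]
  rw [hTv, smul_sub, mul_smul, neg_smul, smul_neg]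
  abel

variable [CompleteSpace X]

theorem integral_exp_smul_op (hR : IsResolventAt T.generator z R) (v : X) {q : ℝ} (hq : 0 ≤ q) :
    ∫ r in (0 : ℝ)..q, Complex.exp (-(z * r)) • T.op r.toNNReal v =
      Complex.exp (-(z * q)) • T.op q.toNNReal (R v) - R v := by
  have hc (w : X) : Continuous fun r : ℝ => Complex.exp (-(z * r)) • T.op r.toNNReal w := by
    have := T.continuous_op_toNNReal w
    fun_prop
  rw [intervalIntegral.integral_eq_sub_of_hasDeriv_right (hc (R v)).continuousOn
    (fun r hr => hR.hasDerivWithinAt_exp_smul_op v (by simpa [hq] using hr.1.le))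
    ((hc v).intervalIntegrable _ _)]
  simp [T.op_zero]

theorem isMildSolution_exp_smul (hR : IsResolventAt T.generator z R) (v : X) :
    T.IsMildSolution (fun t => Complex.exp (z * t) • R v) fun t => Complex.exp (z * t) • v := by
  intro s t hst
  have hshift : ∫ τ in s..t, T.op (t - τ).toNNReal (Complex.exp (z * τ) • v) =
      Complex.exp (z * t) • ∫ r in (0 : ℝ)..(t - s),
        Complex.exp (-(z * r)) • T.op r.toNNReal v := by
    rw [← intervalIntegral.integral_smul, ← sub_self t, ← intervalIntegral.integral_comp_sub_left]
    congr 1 with τ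
    rw [map_smul, smul_smul, ← Complex.exp_add]
    congr 2
    push_cast
    ring
  rw [hshift, hR.integral_exp_smul_op v (sub_nonneg.2 hst), smul_sub, smul_smul,
    ← Complex.exp_add, map_smul]
  have hexp : z * t + -(z * ((t - s : ℝ) : ℂ)) = z * s := by push_cast; ring
  rw [hexp, sub_sub_cancel]

end IsResolventAt

section FourierSynthesis

variable {B : Type*} [NormedAddCommGroup B] [NormedSpace ℂ B]

theorem norm_exp_I_mul (a b : ℝ) : ‖Complex.exp (Complex.I * a * b)‖ = 1 := by
  rw [show Complex.I * a * b = ((a * b : ℝ) : ℂ) * Complex.I by push_cast; ring,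
    Complex.norm_exp_ofReal_mul_I]

theorem enorm_exp_I_mul (a b : ℝ) : ‖Complex.exp (Complex.I * a * b)‖ₑ = 1 := by
  rw [← ofReal_norm, norm_exp_I_mul, ENNReal.ofReal_one]

/-- The inverse Fourier transform `(1/2π) ∫ Φ(l) exp(i l t) dl`, normalized so that it inverts
`scalarFourier`. -/
noncomputable def fourierSynthesis (Φ : ℝ → B) (t : ℝ) : B :=
  ((2 * Real.pi : ℝ) : ℂ)⁻¹ • ∫ l : ℝ, Complex.exp (Complex.I * l * t) • Φ l

/-- Smooth compactly supported functions of the frequency variable; their inverse Fourier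
transforms are the convolution kernels used for spectral localization. -/
structure IsTestFunction (Φ : ℝ → B) : Prop where
  smooth : ContDiff ℝ ∞ Φ
  hasCompactSupport : HasCompactSupport Φ

theorem integrable_exp_smul {Φ : ℝ → B} (h : Integrable Φ) (t : ℝ) :
    Integrable fun l : ℝ => Complex.exp (Complex.I * l * t) • Φ l :=
  h.mono (AEStronglyMeasurable.smul (by fun_prop) h.1)
    (ae_of_all _ fun l => by rw [norm_smul, norm_exp_I_mul, one_mul])

theorem fourierSynthesis_zero : fourierSynthesis (0 : ℝ → B) = 0 := by
  ext t
  simp [fourierSynthesis]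

theorem fourierSynthesis_sub {Φ Ψ : ℝ → B} (hΦ : Integrable Φ) (hΨ : Integrable Ψ) :
    fourierSynthesis (Φ - Ψ) = fourierSynthesis Φ - fourierSynthesis Ψ := by
  ext t
  simp only [fourierSynthesis, Pi.sub_apply, smul_sub]
  rw [integral_sub (integrable_exp_smul hΦ t) (integrable_exp_smul hΨ t), smul_sub]

theorem fourierSynthesis_comp_mul_left (Φ : ℝ → B) {a : ℝ} (ha : 0 < a) (t : ℝ) :
    fourierSynthesis (fun l => Φ (a * l)) t = a⁻¹ • fourierSynthesis Φ (a⁻¹ * t) := by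
  have hscale := Measure.integral_comp_mul_left
    (fun l : ℝ => Complex.exp (Complex.I * l * (a⁻¹ * t : ℝ)) • Φ l) a
  rw [abs_of_pos (inv_pos.2 ha)] at hscale
  rw [fourierSynthesis, fourierSynthesis, smul_comm, ← hscale]
  congr 3 with l
  congr 2
  push_cast
  have : (a : ℂ) ≠ 0 := by exact_mod_cast ha.ne'
  field_simp

theorem fourierSynthesis_comp_sub_right (Φ : ℝ → B) (c t : ℝ) :
    fourierSynthesis (fun l => Φ (l - c)) t =
      Complex.exp (Complex.I * c * t) • fourierSynthesis Φ t := by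
  have hshift := integral_sub_right_eq_self
    (fun l : ℝ => Complex.exp (Complex.I * (l + c : ℝ) * t) • Φ l) (μ := volume) c
  simp only [sub_add_cancel] at hshift
  rw [fourierSynthesis, fourierSynthesis, smul_comm, hshift]
  congr 1
  rw [← integral_smul]
  congr 1 with l
  rw [smul_smul, ← Complex.exp_add]
  congr 2
  push_cast
  ring

theorem scalarConv_fourierSynthesis {f χ : ℝ → ℂ} (hf : Integrable f) (hχ : Integrable χ) :
    scalarConv f (fourierSynthesis χ) = fourierSynthesis (scalarFourier f * χ) := by
  ext t
  have hint : Integrable (Function.uncurry fun s l : ℝ =>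
      f s * (Complex.exp (Complex.I * l * (t - s : ℝ)) * χ l)) (volume.prod volume) := by
    refine (hf.mul_prod hχ).mono ?_ (ae_of_all _ fun p => ?_)
    · exact hf.1.comp_fst.mul (AEStronglyMeasurable.mul (by fun_prop) hχ.1.comp_snd)
    · simp only [Function.uncurry, norm_mul, norm_exp_I_mul, one_mul, le_refl]
  simp only [scalarConv, fourierSynthesis, smul_eq_mul, mul_left_comm (f _), integral_const_mul]
  congr 1
  simp_rw [← integral_const_mul]
  rw [integral_integral_swap hint]
  congr 1 with l
  rw [Pi.mul_apply, scalarFourier, ← integral_mul_const, ← integral_const_mul]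
  congr 1 with s
  have : Complex.exp (Complex.I * l * (t - s : ℝ)) =
      Complex.exp (Complex.I * l * t) * Complex.exp (-(Complex.I * s * l)) := by
    rw [← Complex.exp_add]; congr 1; push_cast; ring
  rw [this]
  ring

theorem fourierSynthesis_eq_fourierInv (Φ : ℝ → B) (t : ℝ) :
    fourierSynthesis Φ t =
      ((2 * Real.pi : ℝ) : ℂ)⁻¹ • FourierTransformInv.fourierInv Φ (t / (2 * Real.pi)) := by
  rw [fourierSynthesis, Real.fourierInv_eq']
  congr! 5 with l
  simp only [RCLike.inner_apply, conj_trivial]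
  push_cast
  have := Real.pi_ne_zero
  field_simp

namespace IsTestFunction

variable {Φ Ψ : ℝ → B}

theorem integrable (h : IsTestFunction Φ) : Integrable Φ :=
  h.smooth.continuous.integrable_of_hasCompactSupport h.hasCompactSupport

theorem sub (hΦ : IsTestFunction Φ) (hΨ : IsTestFunction Ψ) : IsTestFunction (Φ - Ψ) :=
  ⟨hΦ.smooth.sub hΨ.smooth, hΦ.hasCompactSupport.sub hΨ.hasCompactSupport⟩

theorem mul {φ χ : ℝ → ℂ} (hφ : IsTestFunction φ) (hχ : IsTestFunction χ) :
    IsTestFunction (φ * χ) :=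
  ⟨hφ.smooth.mul hχ.smooth, hχ.hasCompactSupport.mul_left⟩

theorem comp_mul_left (h : IsTestFunction Φ) {a : ℝ} (ha : a ≠ 0) :
    IsTestFunction fun l => Φ (a * l) :=
  ⟨h.smooth.comp (by fun_prop), h.hasCompactSupport.comp_homeomorph (Homeomorph.mulLeft₀ a ha)⟩

theorem comp_sub_right (h : IsTestFunction Φ) (c : ℝ) : IsTestFunction fun l => Φ (l - c) :=
  ⟨h.smooth.comp (by fun_prop), h.hasCompactSupport.comp_homeomorph (Homeomorph.subRight c)⟩

theorem fourierSynthesis_eq_schwartzMap (h : IsTestFunction Φ) (t : ℝ) :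
    fourierSynthesis Φ t = ((2 * Real.pi : ℝ) : ℂ)⁻¹ • FourierTransformInv.fourierInv
      (h.hasCompactSupport.toSchwartzMap h.smooth) (t / (2 * Real.pi)) := by
  rw [fourierSynthesis_eq_fourierInv, SchwartzMap.fourierInv_coe]
  rfl

theorem continuous_fourierSynthesis (h : IsTestFunction Φ) : Continuous (fourierSynthesis Φ) := by
  rw [funext h.fourierSynthesis_eq_schwartzMap]
  fun_prop

theorem exists_norm_fourierSynthesis_le (h : IsTestFunction Φ) :
    ∃ C : ℝ, ∀ t, ‖fourierSynthesis Φ t‖ ≤ C * (1 + t ^ 2)⁻¹ := by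
  set g := FourierTransformInv.fourierInv (h.hasCompactSupport.toSchwartzMap h.smooth)
  obtain ⟨C₀, -, hC₀⟩ := g.decay 0 0
  obtain ⟨C₂, -, hC₂⟩ := g.decay 2 0
  have hπ1 : 1 ≤ 2 * Real.pi := by linarith [Real.pi_gt_three]
  have hc : ‖((2 * Real.pi : ℝ) : ℂ)⁻¹‖ ≤ 1 := by
    rw [norm_inv, Complex.norm_real, Real.norm_of_nonneg (by positivity)]
    exact inv_le_one_of_one_le₀ hπ1
  refine ⟨C₀ + (2 * Real.pi) ^ 2 * C₂, fun t => ?_⟩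
  have h0 := hC₀ (t / (2 * Real.pi))
  have h2 := hC₂ (t / (2 * Real.pi))
  simp only [pow_zero, one_mul, norm_iteratedFDeriv_zero, Real.norm_eq_abs, sq_abs] at h0 h2
  rw [div_pow, div_mul_eq_mul_div, div_le_iff₀ (by positivity)] at h2
  calc ‖fourierSynthesis Φ t‖ ≤ ‖g (t / (2 * Real.pi))‖ := by
        rw [h.fourierSynthesis_eq_schwartzMap, norm_smul]
        exact mul_le_of_le_one_left (norm_nonneg _) hc
    _ ≤ (C₀ + (2 * Real.pi) ^ 2 * C₂) * (1 + t ^ 2)⁻¹ := by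
        rw [← div_eq_mul_inv, le_div_iff₀ (by positivity)]
        linarith

theorem integrable_fourierSynthesis (h : IsTestFunction Φ) :
    Integrable (fourierSynthesis Φ) := by
  obtain ⟨C, hC⟩ := h.exists_norm_fourierSynthesis_le
  exact (integrable_inv_one_add_sq.const_mul C).mono'
    h.continuous_fourierSynthesis.aestronglyMeasurable (ae_of_all _ hC)

theorem scalarFourier_fourierSynthesis {χ : ℝ → ℂ} (h : IsTestFunction χ) :
    scalarFourier (fourierSynthesis χ) = χ := by
  ext l
  set g := h.hasCompactSupport.toSchwartzMap h.smooth
  have hπ : 0 < 2 * Real.pi := by positivity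
  have hscale := Measure.integral_comp_div (fun s : ℝ => Complex.exp (↑(-2 * Real.pi * s * l) *
    Complex.I) • FourierTransformInv.fourierInv g s) (2 * Real.pi)
  rw [abs_of_pos hπ, ← inv_smul_eq_iff₀ hπ.ne'] at hscale
  have hinv : FourierTransform.fourier (FourierTransformInv.fourierInv g) l = χ l := by
    rw [FourierTransform.fourier_fourierInv_eq]; rfl
  rw [← hinv, SchwartzMap.fourier_coe, Real.fourier_real_eq_integral_exp_smul, scalarFourier,
    ← hscale, ← integral_smul]
  congr 1 with t
  rw [h.fourierSynthesis_eq_schwartzMap, Complex.real_smul, smul_eq_mul, smul_eq_mul,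
    Complex.ofReal_inv, mul_assoc, mul_comm (Complex.exp _)]
  congr 3
  push_cast
  have := Real.pi_ne_zero
  field_simp

theorem scalarConv_fourierSynthesis {χ φ : ℝ → ℂ} (hχ : IsTestFunction χ)
    (hφ : IsTestFunction φ) :
    scalarConv (fourierSynthesis χ) (fourierSynthesis φ) = fourierSynthesis (χ * φ) := by
  rw [_root_.scalarConv_fourierSynthesis hχ.integrable_fourierSynthesis hφ.integrable,
    hχ.scalarFourier_fourierSynthesis]

end IsTestFunction

theorem exists_isTestFunction_eq_one_nhds {K U : Set ℝ} (hK : IsCompact K) (hU : IsOpen U)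
    (hKU : K ⊆ U) :
    ∃ φ : ℝ → ℂ, IsTestFunction φ ∧ tsupport φ ⊆ U ∧
      ∃ V : Set ℝ, IsOpen V ∧ K ⊆ V ∧ ∀ l ∈ V, φ l = 1 := by
  obtain ⟨L, hL, hKL, hLU⟩ := exists_compact_between hK hU hKU
  obtain ⟨g, h1, h0, -⟩ := exists_contMDiffMap_one_nhds_of_subset_interior (n := ⊤)
    (modelWithCornersSelf ℝ ℝ) hK.isClosed hKL
  have hsub : tsupport (fun l => (g l : ℂ)) ⊆ L := by
    refine closure_minimal (fun l hl => ?_) hL.isClosed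
    by_contra hn
    exact hl (by simp [h0 l hn])
  have hφ : IsTestFunction fun l => (g l : ℂ) :=
    ⟨Complex.ofRealCLM.contDiff.comp g.contMDiff.contDiff,
      hL.of_isClosed_subset (isClosed_tsupport _) hsub⟩
  obtain ⟨V, hV, hKV, hVg⟩ := mem_nhdsSet_iff_exists.1 h1
  refine ⟨_, hφ, hsub.trans hLU, V, hV, hKV, fun l hl => ?_⟩
  have : g l = 1 := hVg hl
  simp [this]

end FourierSynthesis

section MeanModulus

variable {B : Type*} [NormedAddCommGroup B]

theorem ofReal_mul_lintegral_comp_mul_left (g : ℝ → ℝ≥0∞) {a : ℝ} (ha : 0 < a) :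
    ENNReal.ofReal a * ∫⁻ x, g (a * x) = ∫⁻ x, g x := by
  have h := (Homeomorph.mulLeft₀ a ha.ne').measurableEmbedding.lintegral_map g (μ := volume)
  simp only [Homeomorph.coe_mulLeft₀] at h
  rw [← h, Real.map_volume_mul_left ha.ne', lintegral_smul_measure, abs_of_pos (inv_pos.2 ha),
    smul_eq_mul, ← mul_assoc, ← ENNReal.ofReal_mul ha.le, mul_inv_cancel₀ ha.ne',
    ENNReal.ofReal_one, one_mul]

/-- The `L¹` modulus of continuity `‖g(· - h) - g‖₁`. -/
noncomputable def meanModulus (g : ℝ → B) (h : ℝ) : ℝ≥0∞ := ∫⁻ t, ‖g (t - h) - g t‖ₑ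

theorem meanModulus_zero (g : ℝ → B) : meanModulus g 0 = 0 := by simp [meanModulus]

theorem meanModulus_le {g : ℝ → B} (hg : AEStronglyMeasurable g) (h : ℝ) :
    meanModulus g h ≤ 2 * ∫⁻ t, ‖g t‖ₑ := by
  calc meanModulus g h ≤ ∫⁻ t, (‖g (t - h)‖ₑ + ‖g t‖ₑ) := lintegral_mono fun t => enorm_sub_le
    _ = 2 * ∫⁻ t, ‖g t‖ₑ := by
      rw [lintegral_add_right' _ hg.enorm, lintegral_sub_right_eq_self (fun t => ‖g t‖ₑ) h,
        two_mul]

theorem meanModulus_dilation [NormedSpace ℝ B] (g : ℝ → B) {a : ℝ} (ha : 0 < a) (h : ℝ) :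
    meanModulus (fun t => a • g (a * t)) h = meanModulus g (a * h) := by
  simp only [meanModulus, ← smul_sub, enorm_smul, mul_sub a]
  rw [lintegral_const_mul' _ _ enorm_ne_top, Real.enorm_of_nonneg ha.le,
    ofReal_mul_lintegral_comp_mul_left (fun t => ‖g (t - a * h) - g t‖ₑ) ha]

theorem meanModulus_eq_edist {g : ℝ → B} (hg : Integrable g) (h : ℝ) :
    meanModulus g h =
      edist (Lp.compMeasurePreserving (· - h) (measurePreserving_sub_right volume h)
        (hg.toL1 g)) (hg.toL1 g) := by
  have hm := measurePreserving_sub_right (volume : Measure ℝ) h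
  have hgh : Integrable (g ∘ (· - h)) := hm.integrable_comp_of_integrable hg
  have htranslate : Lp.compMeasurePreserving (· - h) hm (hg.toL1 g) = hgh.toL1 _ := by
    ext1
    filter_upwards [Lp.coeFn_compMeasurePreserving (hg.toL1 g) hm, hgh.coeFn_toL1,
      hm.quasiMeasurePreserving.ae hg.coeFn_toL1] with t h1 h2 h3
    rw [h1, h2]
    exact h3
  rw [htranslate, Integrable.edist_toL1_toL1]
  simp only [edist_eq_enorm_sub]
  rfl

theorem continuous_meanModulus {g : ℝ → B} (hg : Integrable g) : Continuous (meanModulus g) := by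
  let c : ℝ → C(ℝ, ℝ) := fun h => ⟨fun t => t - h, by fun_prop⟩
  have hc : Continuous c := ContinuousMap.continuous_of_continuous_uncurry _ (by
    change Continuous fun p : ℝ × ℝ => p.2 - p.1
    fun_prop)
  rw [funext (meanModulus_eq_edist hg)]
  exact ((continuous_const (y := hg.toL1 g)).compMeasurePreservingLp hc
    (fun h => measurePreserving_sub_right _ h) ENNReal.one_ne_top).edist continuous_const

theorem tendsto_lintegral_mul_meanModulus {k : ℝ → ℝ≥0∞} (hk : AEMeasurable k)
    (hk' : ∫⁻ s, k s ≠ ⊤) {g : ℝ → B} (hg : Integrable g) :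
    Tendsto (fun a : ℝ => ∫⁻ s, k s * meanModulus g (a * s)) (𝓝 0) (𝓝 0) := by
  have hm := continuous_meanModulus hg
  refine tendsto_of_seq_tendsto fun a ha => ?_
  rw [← lintegral_zero (α := ℝ) (μ := volume)]
  refine tendsto_lintegral_of_dominated_convergence' (fun s => k s * (2 * ∫⁻ t, ‖g t‖ₑ))
    (fun n => hk.mul (hm.comp (continuous_const_mul (a n))).aemeasurable)
    (fun n => ae_of_all _ fun s => mul_le_mul_right (meanModulus_le hg.1 _) _) ?_ ?_
  · rw [lintegral_mul_const'' _ hk]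
    exact ENNReal.mul_ne_top hk' (ENNReal.mul_ne_top (by simp) hg.2.ne)
  · filter_upwards [ae_lt_top' hk hk'] with s hs
    have hmod : Tendsto (fun n => meanModulus g (a n * s)) atTop (𝓝 0) := by
      have := ((hm.comp (continuous_mul_const s)).tendsto 0).comp ha
      rwa [Function.comp_apply, zero_mul, meanModulus_zero] at this
    simpa using ENNReal.Tendsto.const_mul hmod (Or.inr hs.ne)

theorem lintegral_enorm_integral_smul_sub_le [NormedSpace ℂ B] {k : ℝ → ℂ}
    (hk : AEStronglyMeasurable k) {g : ℝ → B} (hg : AEStronglyMeasurable g) :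
    ∫⁻ t, ‖∫ s, k s • (g (t - s) - g t)‖ₑ ≤ ∫⁻ s, ‖k s‖ₑ * meanModulus g s := by
  have hm : AEStronglyMeasurable (fun p : ℝ × ℝ => k p.2 • (g (p.1 - p.2) - g p.1))
      (volume.prod volume) :=
    hk.comp_snd.smul ((hg.comp_quasiMeasurePreserving
      (quasiMeasurePreserving_sub_of_right_invariant volume volume)).sub hg.comp_fst)
  calc ∫⁻ t, ‖∫ s, k s • (g (t - s) - g t)‖ₑ
      ≤ ∫⁻ t, ∫⁻ s, ‖k s • (g (t - s) - g t)‖ₑ :=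
        lintegral_mono fun t => enorm_integral_le_lintegral_enorm _
    _ = ∫⁻ s, ∫⁻ t, ‖k s • (g (t - s) - g t)‖ₑ := lintegral_lintegral_swap hm.enorm
    _ = ∫⁻ s, ‖k s‖ₑ * meanModulus g s := by
        simp only [enorm_smul]
        simp_rw [lintegral_const_mul' _ _ (enorm_ne_top (x := k _)), meanModulus]

theorem lintegral_enorm_scalarConv_sub_le [NormedSpace ℂ B] [CompleteSpace B] {f : ℝ → ℂ}
    (hf : Integrable f) {W : ℝ → B} (hW : Integrable W) (l : ℝ) :
    ∫⁻ t, ‖scalarConv f (fun t => Complex.exp (Complex.I * l * t) • W t) t -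
        scalarFourier f l • Complex.exp (Complex.I * l * t) • W t‖ₑ ≤
      ∫⁻ s, ‖f s‖ₑ * meanModulus W s := by
  let k : ℝ → ℂ := fun s => f s * Complex.exp (-(Complex.I * s * l))
  have hk_enorm (s : ℝ) : ‖k s‖ₑ = ‖f s‖ₑ := by
    simp only [k, Complex.exp_neg, enorm_mul]
    rw [enorm_inv (Complex.exp_ne_zero _), enorm_exp_I_mul, inv_one, mul_one]
  have hk : Integrable k :=
    hf.congr'_enorm (hf.1.mul (by fun_prop)) (ae_of_all _ fun s => (hk_enorm s).symm)
  have hmodulate (t s : ℝ) : f s • Complex.exp (Complex.I * l * (t - s : ℝ)) • W (t - s) =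
      Complex.exp (Complex.I * l * t) • k s • W (t - s) := by
    simp only [smul_smul, k]
    rw [mul_left_comm, ← Complex.exp_add]
    congr 3
    push_cast
    ring
  have hconv : ∀ᵐ t, Integrable fun s => k s • W (t - s) :=
    hk.ae_convolution_exists (ContinuousLinearMap.lsmul ℂ ℂ) hW
  calc ∫⁻ t, ‖scalarConv f (fun t => Complex.exp (Complex.I * l * t) • W t) t -
        scalarFourier f l • Complex.exp (Complex.I * l * t) • W t‖ₑ
      = ∫⁻ t, ‖∫ s, k s • (W (t - s) - W t)‖ₑ := by
        refine lintegral_congr_ae ?_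
        filter_upwards [hconv] with t ht
        simp only [scalarConv, hmodulate, smul_sub]
        rw [integral_smul, integral_sub ht (hk.smul_const _), integral_smul_const,
          smul_comm (scalarFourier f l), ← smul_sub, enorm_smul, enorm_exp_I_mul, one_mul,
          scalarFourier]
    _ ≤ ∫⁻ s, ‖k s‖ₑ * meanModulus W s := lintegral_enorm_integral_smul_sub_le hk.1 hW.1
    _ = ∫⁻ s, ‖f s‖ₑ * meanModulus W s := by simp only [hk_enorm]

variable [NormedSpace ℂ B] [CompleteSpace B]

theorem IsTestFunction.tendsto_lintegral_scalarConv_sub {χ : ℝ → ℂ} (hχ : IsTestFunction χ)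
    (h1 : χ 0 = 1) {f : ℝ → B} (hf : Integrable f) :
    Tendsto (fun ε : ℝ => ∫⁻ t, ‖scalarConv (fourierSynthesis fun l => χ (ε * l)) f t - f t‖ₑ)
      (𝓝[>] 0) (𝓝 0) := by
  refine tendsto_of_tendsto_of_tendsto_of_le_of_le' tendsto_const_nhds
    ((tendsto_lintegral_mul_meanModulus hχ.integrable_fourierSynthesis.1.enorm
      hχ.integrable_fourierSynthesis.2.ne hf).mono_left nhdsWithin_le_nhds)
    (.of_forall fun _ => zero_le) ?_
  filter_upwards [self_mem_nhdsWithin] with ε (hε : 0 < ε)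
  have hχε : IsTestFunction fun l => χ (ε * l) := hχ.comp_mul_left hε.ne'
  have hχε0 : scalarFourier (fourierSynthesis fun l => χ (ε * l)) 0 = 1 := by
    simp only [hχε.scalarFourier_fourierSynthesis, mul_zero, h1]
  calc ∫⁻ t, ‖scalarConv (fourierSynthesis fun l => χ (ε * l)) f t - f t‖ₑ
      ≤ ∫⁻ s, ‖fourierSynthesis (fun l => χ (ε * l)) s‖ₑ * meanModulus f s := by
        simpa [hχε0] using lintegral_enorm_scalarConv_sub_le hχε.integrable_fourierSynthesis hf 0
    _ = ENNReal.ofReal ε⁻¹ * ∫⁻ s, ‖fourierSynthesis χ (ε⁻¹ * s)‖ₑ *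
          meanModulus f (ε * (ε⁻¹ * s)) := by
        simp only [fourierSynthesis_comp_mul_left χ hε, mul_inv_cancel_left₀ hε.ne', enorm_smul,
          mul_assoc]
        rw [lintegral_const_mul' _ _ enorm_ne_top, Real.enorm_of_nonneg (inv_pos.2 hε).le]
    _ = ∫⁻ s, ‖fourierSynthesis χ s‖ₑ * meanModulus f (ε * s) :=
        ofReal_mul_lintegral_comp_mul_left
          (fun s => ‖fourierSynthesis χ s‖ₑ * meanModulus f (ε * s)) (inv_pos.2 hε)

theorem IsTestFunction.tendsto_lintegral_scalarConv_sub_scalarFourier_smul {Φ : ℝ → B}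
    (hΦ : IsTestFunction Φ) {f : ℝ → ℂ} (hf : Integrable f) (l₀ : ℝ) :
    Tendsto (fun ε : ℝ => ∫⁻ t, ‖scalarConv f (fourierSynthesis fun l => Φ (ε⁻¹ * (l - l₀))) t -
        scalarFourier f l₀ • fourierSynthesis (fun l => Φ (ε⁻¹ * (l - l₀))) t‖ₑ)
      (𝓝[>] 0) (𝓝 0) := by
  refine tendsto_of_tendsto_of_tendsto_of_le_of_le' tendsto_const_nhds
    ((tendsto_lintegral_mul_meanModulus hf.1.enorm hf.2.ne
      hΦ.integrable_fourierSynthesis).mono_left nhdsWithin_le_nhds)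
    (.of_forall fun _ => zero_le) ?_
  filter_upwards [self_mem_nhdsWithin] with ε (hε : 0 < ε)
  have hsynth : (fourierSynthesis fun l => Φ (ε⁻¹ * (l - l₀))) = fun t : ℝ =>
      Complex.exp (Complex.I * l₀ * t) • ε • fourierSynthesis Φ (ε * t) := funext fun t => by
    rw [fourierSynthesis_comp_sub_right (fun l => Φ (ε⁻¹ * l)),
      fourierSynthesis_comp_mul_left Φ (inv_pos.2 hε), inv_inv]
  have hdil : Integrable fun t => ε • fourierSynthesis Φ (ε * t) :=
    (hΦ.integrable_fourierSynthesis.comp_mul_left' hε.ne').smul ε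
  have := lintegral_enorm_scalarConv_sub_le hf hdil l₀
  simpa only [hsynth, meanModulus_dilation (fourierSynthesis Φ) hε] using this

-- Kernels with spectrum concentrated at `l₀`, of bounded `L¹` norm, turn `f` into `f̂(l₀)`.
theorem exists_integrable_scalarFourier_eq_one {f : ℝ → ℂ} (hf : Integrable f) (l₀ : ℝ)
    {c : ℝ≥0∞} (hc : c ≠ 0) :
    ∃ V : ℝ → ℂ, Integrable V ∧ (∀ᶠ l in 𝓝 l₀, scalarFourier V l = 1) ∧
      ∫⁻ t, ‖scalarConv f V t - scalarFourier f l₀ * V t‖ₑ < c := by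
  obtain ⟨χ, hχ, -, U, hU, h0U, hχU⟩ := exists_isTestFunction_eq_one_nhds
    (isCompact_singleton (x := (0 : ℝ))) isOpen_univ (Set.subset_univ _)
  obtain ⟨ε, hlt, hε⟩ := (((hχ.tendsto_lintegral_scalarConv_sub_scalarFourier_smul hf
    l₀).eventually_lt_const (pos_iff_ne_zero.2 hc)).and self_mem_nhdsWithin).exists
  have hχε : IsTestFunction fun l => χ (ε⁻¹ * (l - l₀)) :=
    (hχ.comp_mul_left (inv_ne_zero (ne_of_gt hε))).comp_sub_right l₀
  refine ⟨_, hχε.integrable_fourierSynthesis, ?_, hlt⟩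
  have hcont : ContinuousAt (fun l : ℝ => ε⁻¹ * (l - l₀)) l₀ := by fun_prop
  filter_upwards [hcont (hU.mem_nhds (h0U (by simp)))] with l hl
  rw [hχε.scalarFourier_fourierSynthesis]
  exact hχU _ hl

end MeanModulus

section Stepanov

/-- The function `x` has a finite Stepanov norm `sup_t ∫₀¹ ‖x (s + t)‖ ds`. Extended nonnegative
functions are allowed as well, so that majorants of convolutions are covered. -/
structure IsStepanov {Y : Type*} [TopologicalSpace Y] [ContinuousENorm Y] (x : ℝ → Y) : Prop where
  aestronglyMeasurable : AEStronglyMeasurable x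
  bound : ∃ C : ℝ≥0∞, C ≠ ⊤ ∧ ∀ t : ℝ, ∫⁻ s in Set.Icc (0 : ℝ) 1, ‖x (s + t)‖ₑ ≤ C

theorem aemeasurable_mul_comp_sub {k g : ℝ → ℝ≥0∞} (hk : AEMeasurable k) (hg : AEMeasurable g) :
    AEMeasurable (fun p : ℝ × ℝ => k p.2 * g (p.1 - p.2)) (volume.prod volume) :=
  hk.comp_snd.mul (hg.comp_quasiMeasurePreserving (quasiMeasurePreserving_sub volume volume))

theorem setLIntegral_lintegral_mul_comp_sub_le {k g : ℝ → ℝ≥0∞} (hk : AEMeasurable k)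
    (hg : AEMeasurable g) {S : Set ℝ} {C : ℝ≥0∞} (h : ∀ t, ∫⁻ τ in S, g (τ + t) ≤ C) (t : ℝ) :
    ∫⁻ τ in S, ∫⁻ s, k s * g (τ + t - s) ≤ (∫⁻ s, k s) * C := by
  have hgt : AEMeasurable fun τ => g (τ + t) :=
    hg.comp_quasiMeasurePreserving (measurePreserving_add_right volume t).quasiMeasurePreserving
  have hswap : ∫⁻ τ in S, ∫⁻ s, k s * g (τ + t - s) = ∫⁻ s, ∫⁻ τ in S, k s * g (τ + t - s) := by
    refine lintegral_lintegral_swap (AEMeasurable.mono_ac ?_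
      (Measure.absolutelyContinuous_restrict.prod Measure.AbsolutelyContinuous.rfl))
    simpa only [Function.uncurry_def, sub_add_eq_add_sub] using aemeasurable_mul_comp_sub hk hgt
  rw [hswap, ← lintegral_mul_const'' _ hk]
  refine lintegral_mono fun s => ?_
  have hgs : AEMeasurable fun τ => g (τ + (t - s)) :=
    hg.comp_quasiMeasurePreserving
      (measurePreserving_add_right volume (t - s)).quasiMeasurePreserving
  simp only [add_sub_assoc]
  rw [lintegral_const_mul'' _ hgs.restrict]
  exact mul_le_mul_right (h (t - s)) _

theorem inv_one_add_sq_le (s : ℝ) {a : ℝ} (h0 : 0 ≤ a) (h1 : a ≤ 1) :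
    (1 + s ^ 2)⁻¹ ≤ 3 * (1 + (s + a) ^ 2)⁻¹ := by
  rw [← div_eq_mul_inv, inv_le_comm₀ (by positivity) (by positivity), inv_div,
    div_le_iff₀ (by positivity)]
  nlinarith [sq_nonneg (s - a), sq_nonneg s]

namespace IsStepanov

section ENorm

variable {Y : Type*} [TopologicalSpace Y] [ContinuousENorm Y] {x : ℝ → Y}

theorem congr_ae {x' : ℝ → Y} (hx : IsStepanov x) (h : x =ᵐ[volume] x') : IsStepanov x' := by
  obtain ⟨C, hC, hbound⟩ := hx.bound
  refine ⟨hx.aestronglyMeasurable.congr h, C, hC, fun t => le_of_eq_of_le ?_ (hbound t)⟩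
  refine lintegral_congr_ae (ae_restrict_of_ae ?_)
  filter_upwards [(measurePreserving_add_right volume t).quasiMeasurePreserving.ae h] with s hs
  rw [hs]

theorem exists_setLIntegral_Icc_le (hx : IsStepanov x) :
    ∃ C : ℝ≥0∞, C ≠ ⊤ ∧ ∀ t : ℝ, ∫⁻ s in Set.Icc (t - 1) t, ‖x s‖ₑ ≤ C := by
  obtain ⟨C, hC, hbound⟩ := hx.bound
  refine ⟨C, hC, fun t => le_of_eq_of_le ?_ (hbound (t - 1))⟩
  have hshift := (measurePreserving_add_right volume (t - 1)).setLIntegral_comp_preimage_emb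
    (measurableEmbedding_addRight _) (fun s => ‖x s‖ₑ) (Set.Icc (t - 1) t)
  rw [← hshift, Set.preimage_add_const_Icc, sub_self, sub_sub_cancel]

theorem setLIntegral_Icc_ne_top (hx : IsStepanov x) (a b : ℝ) :
    ∫⁻ t in Set.Icc a b, ‖x t‖ₑ ≠ ⊤ := by
  obtain ⟨C, hC, hbound⟩ := hx.bound
  obtain ⟨N, hN⟩ := exists_nat_gt (b - a)
  set I : Fin N → Set ℝ := fun i => (· - (a + (i : ℕ))) ⁻¹' Set.Icc 0 1
  have hcover : Set.Icc a b ⊆ ⋃ i, I i := by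
    intro t ht
    have h0 : 0 ≤ t - a := sub_nonneg.2 ht.1
    have hfloor := Nat.floor_le h0
    have hlt := Nat.lt_floor_add_one (t - a)
    simp only [I, Set.mem_iUnion, Set.mem_preimage, Set.mem_Icc]
    exact ⟨⟨⌊t - a⌋₊, (Nat.floor_lt h0).2 (by linarith [ht.2])⟩, by linarith, by linarith⟩
  have hpiece : ∀ i, ∫⁻ t in I i, ‖x t‖ₑ ≤ C := fun i => by
    have hshift := (measurePreserving_sub_right volume
      (a + (i : ℕ) : ℝ)).setLIntegral_comp_preimage_emb (measurableEmbedding_subRight _)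
      (fun s => ‖x (s + (a + (i : ℕ)))‖ₑ) (Set.Icc 0 1)
    simp only [sub_add_cancel] at hshift
    exact hshift.trans_le (hbound _)
  refine ne_top_of_le_ne_top (ENNReal.mul_ne_top (ENNReal.natCast_ne_top N) hC) ?_
  calc ∫⁻ t in Set.Icc a b, ‖x t‖ₑ
      ≤ ∫⁻ t in ⋃ i, I i, ‖x t‖ₑ := lintegral_mono_set hcover
    _ ≤ ∑ i, ∫⁻ t in I i, ‖x t‖ₑ := (lintegral_iUnion_le _ _).trans_eq (tsum_fintype _)
    _ ≤ ∑ _i : Fin N, C := Finset.sum_le_sum fun i _ => hpiece i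
    _ = N * C := by simp

theorem ae_enorm_lt_top (hx : IsStepanov x) : ∀ᵐ t, ‖x t‖ₑ < ⊤ := by
  have hIcc : ∀ n : ℕ, ∀ᵐ t, t ∈ Set.Icc (-(n : ℝ)) n → ‖x t‖ₑ < ⊤ := fun n =>
    (ae_restrict_iff' measurableSet_Icc).1 (ae_lt_top' hx.aestronglyMeasurable.enorm.restrict
      (hx.setLIntegral_Icc_ne_top _ _))
  filter_upwards [ae_all_iff.2 hIcc] with t ht
  obtain ⟨n, hn⟩ := exists_nat_ge |t|
  exact ht n (abs_le.1 hn)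

theorem lintegral_mul_comp_sub (hx : IsStepanov x) {k : ℝ → ℝ≥0∞} (hk : AEMeasurable k)
    (hk' : ∫⁻ s, k s ≠ ⊤) : IsStepanov fun t => ∫⁻ s, k s * ‖x (t - s)‖ₑ := by
  obtain ⟨C, hC, hbound⟩ := hx.bound
  exact ⟨(aemeasurable_mul_comp_sub hk
      hx.aestronglyMeasurable.enorm).lintegral_prod_right'.aestronglyMeasurable, _,
    ENNReal.mul_ne_top hk' hC,
    setLIntegral_lintegral_mul_comp_sub_le hk hx.aestronglyMeasurable.enorm hbound⟩

theorem lintegral_inv_one_add_sq_mul_comp_sub_lt_top (hx : IsStepanov x) (t : ℝ) :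
    ∫⁻ s, ENNReal.ofReal (1 + s ^ 2)⁻¹ * ‖x (t - s)‖ₑ < ⊤ := by
  obtain ⟨C, hC, hbound⟩ := hx.bound
  set w : ℝ → ℝ≥0∞ := fun s => ENNReal.ofReal (1 + s ^ 2)⁻¹
  have hxm := hx.aestronglyMeasurable.enorm
  have hw_int : ∫⁻ s, w s ≠ ⊤ := integrable_inv_one_add_sq.lintegral_lt_top.ne
  have hw_meas : AEMeasurable fun s => 3 * w s := Measurable.aemeasurable (by fun_prop)
  have hshift : ∀ a ∈ Set.Icc (0 : ℝ) 1,
      ∫⁻ s, w s * ‖x (t - s)‖ₑ ≤ ∫⁻ s, 3 * w s * ‖x (a + t - s)‖ₑ := fun a ha => by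
    rw [← lintegral_add_right_eq_self (fun s => 3 * w s * ‖x (a + t - s)‖ₑ) a]
    refine lintegral_mono fun s => ?_
    rw [add_comm a t, add_sub_add_right_eq_sub]
    refine mul_le_mul_left ?_ _
    have := ENNReal.ofReal_le_ofReal (inv_one_add_sq_le s ha.1 ha.2)
    rwa [ENNReal.ofReal_mul (by norm_num), ENNReal.ofReal_ofNat] at this
  calc ∫⁻ s, w s * ‖x (t - s)‖ₑ
      = ∫⁻ _ in Set.Icc (0 : ℝ) 1, ∫⁻ s, w s * ‖x (t - s)‖ₑ := by simp
    _ ≤ ∫⁻ a in Set.Icc (0 : ℝ) 1, ∫⁻ s, 3 * w s * ‖x (a + t - s)‖ₑ :=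
        setLIntegral_mono' measurableSet_Icc hshift
    _ ≤ (∫⁻ s, 3 * w s) * C := setLIntegral_lintegral_mul_comp_sub_le hw_meas hxm hbound t
    _ < ⊤ := by
        rw [lintegral_const_mul' _ _ (by simp)]
        finiteness

end ENorm

variable {X : Type*} [NormedAddCommGroup X] {x : ℝ → X}

theorem locallyIntegrable (hx : IsStepanov x) : LocallyIntegrable x :=
  locallyIntegrable_iff.2 fun K hK => by
    obtain ⟨R, hR⟩ := hK.isBounded.subset_closedBall 0
    rw [Real.closedBall_eq_Icc] at hR
    exact IntegrableOn.mono_set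
      ⟨hx.aestronglyMeasurable.restrict, (hx.setLIntegral_Icc_ne_top _ _).lt_top⟩ hR

theorem aestronglyMeasurable_comp_sub_left (hx : IsStepanov x) (t : ℝ) :
    AEStronglyMeasurable fun s => x (t - s) :=
  hx.aestronglyMeasurable.comp_measurePreserving (Measure.measurePreserving_sub_left volume t)

variable [NormedSpace ℂ X]

theorem integrable_opConv_of_lintegral (hx : IsStepanov x) {K : ℝ → X →L[ℂ] X}
    (hK : AEStronglyMeasurable K) {t : ℝ} (h : ∫⁻ s, ‖K s‖ₑ * ‖x (t - s)‖ₑ < ⊤) :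
    Integrable fun s => K s (x (t - s)) :=
  ⟨(ContinuousLinearMap.id ℂ _).aestronglyMeasurable_comp₂ hK
      (hx.aestronglyMeasurable_comp_sub_left t),
    (lintegral_mono fun s => (K s).le_opENorm _).trans_lt h⟩

theorem ae_integrable_opConv (hx : IsStepanov x) {K : ℝ → X →L[ℂ] X} (hK : Integrable K) :
    ∀ᵐ t, Integrable fun s => K s (x (t - s)) := by
  filter_upwards [(hx.lintegral_mul_comp_sub hK.1.enorm hK.2.ne).ae_enorm_lt_top] with t ht
  exact hx.integrable_opConv_of_lintegral hK.1 ht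

theorem integrable_opConv_of_decay (hx : IsStepanov x) {K : ℝ → X →L[ℂ] X}
    (hK : AEStronglyMeasurable K) {C : ℝ} (hC : ∀ s, ‖K s‖ ≤ C * (1 + s ^ 2)⁻¹) (t : ℝ) :
    Integrable fun s => K s (x (t - s)) := by
  have hK_le : ∀ s, ‖K s‖ₑ ≤ ENNReal.ofReal C * ENNReal.ofReal (1 + s ^ 2)⁻¹ := fun s => by
    rw [← ENNReal.ofReal_mul' (by positivity), ← ofReal_norm]
    exact ENNReal.ofReal_le_ofReal (hC s)
  refine hx.integrable_opConv_of_lintegral hK ?_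
  calc ∫⁻ s, ‖K s‖ₑ * ‖x (t - s)‖ₑ
      ≤ ∫⁻ s, ENNReal.ofReal C * (ENNReal.ofReal (1 + s ^ 2)⁻¹ * ‖x (t - s)‖ₑ) :=
        lintegral_mono fun s => by
          rw [← mul_assoc]
          exact mul_le_mul_left (hK_le s) _
    _ = ENNReal.ofReal C * ∫⁻ s, ENNReal.ofReal (1 + s ^ 2)⁻¹ * ‖x (t - s)‖ₑ :=
        lintegral_const_mul' _ _ (by simp)
    _ < ⊤ := ENNReal.mul_lt_top (by simp) (hx.lintegral_inv_one_add_sq_mul_comp_sub_lt_top t)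

end IsStepanov

end Stepanov

section OperatorConvolution

variable {X : Type*} [NormedAddCommGroup X] [NormedSpace ℂ X]

theorem opConv_congr_ae {x x' : ℝ → X} (h : x =ᵐ[volume] x') (K : ℝ → X →L[ℂ] X) :
    opConv K x = opConv K x' := by
  ext t
  refine integral_congr_ae ?_
  filter_upwards [(Measure.measurePreserving_sub_left volume t).quasiMeasurePreserving.ae h]
    with s hs
  rw [hs]

theorem scalarConv_eq_opConv (f : ℝ → ℂ) (x : ℝ → X) :
    scalarConv f x = opConv (fun s => f s • (1 : X →L[ℂ] X)) x := rfl

namespace IsStepanov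

variable {x : ℝ → X} {K L : ℝ → X →L[ℂ] X}

theorem ae_integrable_opConv_opConv (hx : IsStepanov x) (hK : Integrable K)
    (hL : Integrable L) : ∀ᵐ t, Integrable
      (fun p : ℝ × ℝ => K p.1 (L p.2 (x (t - p.1 - p.2)))) (volume.prod volume) := by
  have hLx := hx.lintegral_mul_comp_sub hL.1.enorm hL.2.ne
  have hKLx := hLx.lintegral_mul_comp_sub hK.1.enorm hK.2.ne
  filter_upwards [hKLx.ae_enorm_lt_top] with t ht
  have hx_meas : AEStronglyMeasurable (fun p : ℝ × ℝ => x (t - p.1 - p.2))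
      (volume.prod volume) := by
    simpa only [Function.comp_def, sub_add_eq_sub_sub] using
      hx.aestronglyMeasurable.comp_quasiMeasurePreserving
        ((quasiMeasurePreserving_sub_left volume t).comp (quasiMeasurePreserving_add volume volume))
  have hmeas : AEStronglyMeasurable (fun p : ℝ × ℝ => K p.1 (L p.2 (x (t - p.1 - p.2))))
      (volume.prod volume) :=
    (ContinuousLinearMap.id ℂ _).aestronglyMeasurable_comp₂ hK.1.comp_fst
      ((ContinuousLinearMap.id ℂ _).aestronglyMeasurable_comp₂ hL.1.comp_snd hx_meas)
  refine ⟨hmeas, ?_⟩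
  rw [HasFiniteIntegral, lintegral_prod _ hmeas.enorm]
  refine (lintegral_mono fun s => ?_).trans_lt ht
  rw [enorm_eq_self, ← lintegral_const_mul' _ _ enorm_ne_top]
  exact lintegral_mono fun r => ((K s).le_opENorm _).trans
    (mul_le_mul_right ((L r).le_opENorm _) _)

variable [CompleteSpace X]

theorem opConv_opConv (hx : IsStepanov x) (hK : Integrable K) (hL : Integrable L) :
    opConv K (opConv L x) =ᵐ[volume]
      fun t => ∫ p : ℝ × ℝ, K p.1 (L p.2 (x (t - p.1 - p.2))) ∂(volume.prod volume) := by
  filter_upwards [hx.ae_integrable_opConv_opConv hK hL] with t ht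
  rw [integral_prod _ ht]
  refine integral_congr_ae ?_
  filter_upwards [(Measure.measurePreserving_sub_left volume t).quasiMeasurePreserving.ae
    (hx.ae_integrable_opConv hL)] with s hs
  exact ((K s).integral_comp_comm hs).symm

theorem opConv_comm (hx : IsStepanov x) (hK : Integrable K) (hL : Integrable L)
    (hKL : ∀ s r v, K s (L r v) = L r (K s v)) :
    opConv K (opConv L x) =ᵐ[volume] opConv L (opConv K x) := by
  filter_upwards [hx.opConv_opConv hK hL, hx.opConv_opConv hL hK] with t hKLx hLKx
  rw [hKLx, hLKx, ← integral_prod_swap]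
  simp only [Prod.fst_swap, Prod.snd_swap, hKL, sub_right_comm]

theorem scalarConv_scalarConv (hx : IsStepanov x) {f g : ℝ → ℂ} (hf : Integrable f)
    (hg : Integrable g) :
    scalarConv f (scalarConv g x) =ᵐ[volume] scalarConv (scalarConv f g) x := by
  have hf' := hf.smul_const (1 : X →L[ℂ] X)
  have hg' := hg.smul_const (1 : X →L[ℂ] X)
  filter_upwards [hx.opConv_opConv hf' hg', hx.ae_integrable_opConv_opConv hf' hg'] with t ht hint
  simp only [smul_apply, one_apply_eq_self] at ht hint
  set G : ℝ × ℝ → X := fun p => f p.1 • g p.2 • x (t - p.1 - p.2)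
  have hshear := measurePreserving_prod_sub (volume : Measure ℝ) (volume : Measure ℝ)
  have hemb : MeasurableEmbedding fun p : ℝ × ℝ => (p.1, p.2 - p.1) :=
    (MeasurableEquiv.shearSubRight ℝ).measurableEmbedding
  calc opConv (fun s => f s • 1) (opConv (fun s => g s • 1) x) t
      = ∫ p, G p ∂(volume.prod volume) := ht
    _ = ∫ p, (G ∘ fun p => (p.1, p.2 - p.1)) p ∂(volume.prod volume) :=
        (hshear.integral_comp hemb G).symm
    _ = ∫ r, ∫ s, (f s • g (r - s)) • x (t - r) := by
        rw [integral_prod_symm _ ((hshear.integrable_comp_emb hemb).2 hint)]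
        simp only [G, Function.comp_apply, smul_smul, smul_eq_mul, sub_sub, add_sub_cancel]
    _ = scalarConv (scalarConv f g) x t := by
        simp only [integral_smul_const]
        rfl

end IsStepanov

end OperatorConvolution

theorem integrable_scalarConv {f g : ℝ → ℂ} (hf : Integrable f) (hg : Integrable g) :
    Integrable (scalarConv f g) :=
  hf.integrable_convolution (ContinuousLinearMap.lsmul ℂ ℂ) hg

section MemL1s

variable {X : Type*} [NormedAddCommGroup X] [NormedSpace ℂ X] {K : ℝ → X →L[ℂ] X}

theorem isMajorant_norm_of_integrable (hK : Integrable K) : IsMajorant K fun s => ‖K s‖ :=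
  ⟨hK.norm, ae_of_all _ fun _ => le_rfl⟩

theorem memL1s_of_integrable (hK : Integrable K) : MemL1s K :=
  ⟨fun v => hK.1.apply_continuousLinearMap v, _, isMajorant_norm_of_integrable hK⟩

theorem normL1s_le_integral_norm (hK : Integrable K) : normL1s K ≤ ∫ s, ‖K s‖ := by
  refine csInf_le ⟨0, ?_⟩ ⟨_, isMajorant_norm_of_integrable hK, by simp⟩
  rintro c ⟨f, -, rfl⟩
  exact integral_nonneg fun s => norm_nonneg _

end MemL1s

namespace HomogeneousSpace

section Action

variable {X E : Type*} [NormedAddCommGroup X] [NormedSpace ℂ X]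
  [NormedAddCommGroup E] [NormedSpace ℂ E] (F : HomogeneousSpace X E)

theorem isStepanov (x : E) : IsStepanov (F.toAE x) := by
  obtain ⟨C, hC⟩ := F.stepanov_bound
  exact ⟨(F.toAE x).aestronglyMeasurable, _, ENNReal.ofReal_ne_top, hC x⟩

theorem ext_ae {x y : E} (h : F.toAE x =ᵐ[volume] F.toAE y) : x = y :=
  F.toAE_injective (AEEqFun.ext h)

theorem toAE_sub_ae (x y : E) : F.toAE (x - y) =ᵐ[volume] fun t => F.toAE x t - F.toAE y t := by
  rw [map_sub]
  exact AEEqFun.coeFn_sub _ _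

theorem toAE_smul_ae (c : ℂ) (x : E) : F.toAE (c • x) =ᵐ[volume] fun t => c • F.toAE x t := by
  rw [map_smul]
  exact AEEqFun.coeFn_smul _ _

theorem toAE_zero_ae : F.toAE 0 =ᵐ[volume] 0 := by
  rw [map_zero]
  exact AEEqFun.coeFn_zero

open Classical in
/-- The convolution `K * x` with an operator-valued kernel, as an element of the homogeneous
space; it is `0` unless `K ∈ L¹ₛ(ℝ, B(X))`. -/
noncomputable def act (K : ℝ → X →L[ℂ] X) (x : E) : E :=
  if h : MemL1s K then Classical.choose (F.convolution K h x) else 0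

/-- The convolution `f * x` with a scalar kernel, as an element of the homogeneous space. -/
noncomputable def sact (f : ℝ → ℂ) (x : E) : E :=
  F.act (fun s => f s • (1 : X →L[ℂ] X)) x

variable {K L : ℝ → X →L[ℂ] X} {f g : ℝ → ℂ}

theorem toAE_act (hK : Integrable K) (x : E) :
    F.toAE (F.act K x) =ᵐ[volume] opConv K (F.toAE x) := by
  rw [act, dif_pos (memL1s_of_integrable hK)]
  exact (Classical.choose_spec (F.convolution K (memL1s_of_integrable hK) x)).1

theorem enorm_act_le (hK : Integrable K) (x : E) :
    ‖F.act K x‖ₑ ≤ (∫⁻ s, ‖K s‖ₑ) * ‖x‖ₑ := by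
  rw [act, dif_pos (memL1s_of_integrable hK), ← ofReal_integral_norm_eq_lintegral_enorm hK,
    ← ofReal_norm, ← ofReal_norm, ← ENNReal.ofReal_mul (by positivity)]
  exact ENNReal.ofReal_le_ofReal
    ((Classical.choose_spec (F.convolution K (memL1s_of_integrable hK) x)).2.trans
      (mul_le_mul_of_nonneg_right (normL1s_le_integral_norm hK) (norm_nonneg _)))

theorem toAE_sact (hf : Integrable f) (x : E) :
    F.toAE (F.sact f x) =ᵐ[volume] scalarConv f (F.toAE x) :=
  F.toAE_act (hf.smul_const _) x

theorem enorm_sact_le (hf : Integrable f) (x : E) :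
    ‖F.sact f x‖ₑ ≤ (∫⁻ s, ‖f s‖ₑ) * ‖x‖ₑ := by
  refine (F.enorm_act_le (hf.smul_const _) x).trans
    (mul_le_mul_left (lintegral_mono fun s => ?_) _)
  rw [enorm_smul]
  exact mul_le_of_le_one_right' ((ContinuousLinearMap.opENorm_le_bound _ fun v => by simp))

theorem sact_eq_zero_iff (hf : Integrable f) (x : E) :
    F.sact f x = 0 ↔ ∀ᵐ t, scalarConv f (F.toAE x) t = 0 := by
  refine ⟨fun hzero => ?_, fun hzero => F.ext_ae ?_⟩
  · have hsact := F.toAE_sact hf x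
    rw [hzero] at hsact
    exact hsact.symm.trans F.toAE_zero_ae
  · exact (F.toAE_sact hf x).trans (EventuallyEq.trans hzero F.toAE_zero_ae.symm)

theorem act_sub (hK : Integrable K) (x y : E) : F.act K (x - y) = F.act K x - F.act K y := by
  refine F.ext_ae ?_
  filter_upwards [F.toAE_act hK (x - y), F.toAE_sub_ae (F.act K x) (F.act K y), F.toAE_act hK x,
    F.toAE_act hK y, (F.isStepanov x).ae_integrable_opConv hK,
    (F.isStepanov y).ae_integrable_opConv hK] with t hxy hsub hx hy hx_int hy_int
  rw [hxy, hsub, hx, hy, opConv_congr_ae (F.toAE_sub_ae x y)]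
  simp only [opConv, map_sub]
  exact integral_sub hx_int hy_int

theorem act_zero (hK : Integrable K) : F.act K 0 = 0 := by
  simpa only [sub_self] using F.act_sub hK 0 0

theorem sact_sub (hf : Integrable f) (x y : E) :
    F.sact f (x - y) = F.sact f x - F.sact f y :=
  F.act_sub (hf.smul_const (1 : X →L[ℂ] X)) x y

theorem sact_zero (hf : Integrable f) : F.sact f 0 = 0 :=
  F.act_zero (hf.smul_const (1 : X →L[ℂ] X))

theorem sact_sub_left (hf : Integrable f) (hg : Integrable g) (x : E) :
    F.sact (f - g) x = F.sact f x - F.sact g x := by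
  refine F.ext_ae ?_
  filter_upwards [F.toAE_sact (hf.sub hg) x, F.toAE_sub_ae (F.sact f x) (F.sact g x),
    F.toAE_sact hf x, F.toAE_sact hg x,
    (F.isStepanov x).ae_integrable_opConv (hf.smul_const (1 : X →L[ℂ] X)),
    (F.isStepanov x).ae_integrable_opConv (hg.smul_const (1 : X →L[ℂ] X))]
    with t hfg hsub hft hgt hf_int hg_int
  rw [hfg, hsub, hft, hgt]
  simp only [scalarConv, Pi.sub_apply, sub_smul]
  exact integral_sub hf_int hg_int

theorem sact_const_smul (hf : Integrable f) (c : ℂ) (x : E) :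
    F.sact (c • f) x = c • F.sact f x := by
  refine F.ext_ae ?_
  filter_upwards [F.toAE_sact (hf.smul c) x, F.toAE_smul_ae c (F.sact f x), F.toAE_sact hf x]
    with t hcf hsmul hft
  rw [hcf, hsmul, hft]
  simp only [scalarConv, Pi.smul_apply, smul_assoc]
  exact integral_smul _ _

theorem beurlingSpectrum_subset_of_sact {x y : E}
    (h : ∀ f : ℝ → ℂ, Integrable f → F.sact f x = 0 → F.sact f y = 0) :
    F.beurlingSpectrum y ⊆ F.beurlingSpectrum x :=
  Set.compl_subset_compl.2 fun _ ⟨f, hf, hl, hfx⟩ =>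
    ⟨f, hf, hl, (F.sact_eq_zero_iff hf y).1 (h f hf ((F.sact_eq_zero_iff hf x).2 hfx))⟩

theorem sact_fourierSynthesis_sub {χ φ : ℝ → ℂ} (hχ : IsTestFunction χ)
    (hφ : IsTestFunction φ) (x : E) :
    F.sact (fourierSynthesis (χ - φ)) x =
      F.sact (fourierSynthesis χ) x - F.sact (fourierSynthesis φ) x := by
  rw [fourierSynthesis_sub hχ.integrable hφ.integrable, F.sact_sub_left
    hχ.integrable_fourierSynthesis hφ.integrable_fourierSynthesis]

variable [CompleteSpace X]

theorem act_act_comm (hK : Integrable K) (hL : Integrable L)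
    (hKL : ∀ s r v, K s (L r v) = L r (K s v)) (x : E) :
    F.act K (F.act L x) = F.act L (F.act K x) := by
  refine F.ext_ae ?_
  filter_upwards [F.toAE_act hK (F.act L x), F.toAE_act hL (F.act K x),
    (F.isStepanov x).opConv_comm hK hL hKL] with t hKLx hLKx hcomm
  rw [hKLx, hLKx, opConv_congr_ae (F.toAE_act hL x), hcomm, opConv_congr_ae (F.toAE_act hK x)]

theorem sact_act_comm (hf : Integrable f) (hK : Integrable K) (x : E) :
    F.sact f (F.act K x) = F.act K (F.sact f x) :=
  F.act_act_comm (hf.smul_const (1 : X →L[ℂ] X)) hK (fun s r v => by simp) x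

theorem sact_sact_comm (hf : Integrable f) (hg : Integrable g) (x : E) :
    F.sact f (F.sact g x) = F.sact g (F.sact f x) :=
  F.sact_act_comm hf (hg.smul_const (1 : X →L[ℂ] X)) x

theorem sact_sact (hf : Integrable f) (hg : Integrable g) (x : E) :
    F.sact f (F.sact g x) = F.sact (scalarConv f g) x := by
  refine F.ext_ae ?_
  filter_upwards [F.toAE_sact hf (F.sact g x), F.toAE_sact (integrable_scalarConv hf hg) x,
    (F.isStepanov x).scalarConv_scalarConv hf hg] with t hfgx hfg hassoc
  rw [hfgx, hfg, ← hassoc, scalarConv_eq_opConv, opConv_congr_ae (F.toAE_sact hg x)]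
  rfl

theorem sact_fourierSynthesis_sact {χ φ : ℝ → ℂ} (hχ : IsTestFunction χ)
    (hφ : IsTestFunction φ) (x : E) :
    F.sact (fourierSynthesis χ) (F.sact (fourierSynthesis φ) x) =
      F.sact (fourierSynthesis (χ * φ)) x := by
  rw [F.sact_sact hχ.integrable_fourierSynthesis hφ.integrable_fourierSynthesis,
    hχ.scalarConv_fourierSynthesis hφ]

end Action

end HomogeneousSpace

theorem tsupport_sub_mul_subset_diff {χ φ : ℝ → ℂ} {W : Set ℝ} (hW : IsOpen W)
    (h1 : ∀ l ∈ W, φ l = 1) : tsupport (χ - χ * φ) ⊆ tsupport χ \ W := by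
  refine closure_minimal (fun l hl => ⟨subset_closure fun h0 => hl ?_, fun hlW => hl ?_⟩)
    ((isClosed_tsupport _).inter hW.isClosed_compl)
  · simp [h0]
  · simp [h1 l hlW]

namespace HomogeneousSpace

variable {X E : Type*} [NormedAddCommGroup X] [NormedSpace ℂ X]
  [NormedAddCommGroup E] [NormedSpace ℂ E]

/-- The Fourier transform of `x`, as a distribution, vanishes on `U`: this is tested by
convolution with the kernels whose Fourier transforms are test functions supported in `U`. -/
def SpectrumVanishesOn (F : HomogeneousSpace X E) (x : E) (U : Set ℝ) : Prop :=
  ∀ χ : ℝ → ℂ, IsTestFunction χ → tsupport χ ⊆ U → F.sact (fourierSynthesis χ) x = 0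

theorem spectrumVanishesOn_empty (F : HomogeneousSpace X E) (x : E) :
    F.SpectrumVanishesOn x ∅ := by
  intro χ hχ hempty
  obtain rfl : χ = 0 := tsupport_eq_empty_iff.1 (Set.subset_empty_iff.1 hempty)
  refine (F.sact_eq_zero_iff hχ.integrable_fourierSynthesis x).2 (ae_of_all _ fun t => ?_)
  simp [scalarConv, fourierSynthesis_zero]

variable {F : HomogeneousSpace X E} {x : E}

theorem SpectrumVanishesOn.union {U V : Set ℝ} (hxU : F.SpectrumVanishesOn x U)
    (hxV : F.SpectrumVanishesOn x V) (hU : IsOpen U) (hV : IsOpen V) :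
    F.SpectrumVanishesOn x (U ∪ V) := by
  intro χ hχ hχUV
  obtain ⟨ρ, hρ, hρU, W, hW, hW_cover, hρW⟩ := exists_isTestFunction_eq_one_nhds
    (hχ.hasCompactSupport.diff hV) hU fun l hl => (hχUV hl.1).resolve_right hl.2
  have hU_part : F.sact (fourierSynthesis (χ * ρ)) x = 0 :=
    hxU _ (hχ.mul hρ) (tsupport_mul_subset_right.trans hρU)
  have hV_part : F.sact (fourierSynthesis (χ - χ * ρ)) x = 0 := by
    refine hxV _ (hχ.sub (hχ.mul hρ)) fun l hl => ?_
    obtain ⟨hlχ, hlW⟩ := tsupport_sub_mul_subset_diff hW hρW hl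
    exact by_contra fun hlV => hlW (hW_cover ⟨hlχ, hlV⟩)
  rwa [F.sact_fourierSynthesis_sub hχ (hχ.mul hρ), hU_part, sub_zero] at hV_part

variable [CompleteSpace X]

-- `V * u = u` and `f * u = 0` make `f * V - c V` act on `u` as multiplication by `-c`, which a
-- kernel of norm less than `|c|` can only do on `0`.
theorem eq_zero_of_sact_eq_self {f V : ℝ → ℂ} (hf : Integrable f) (hV : Integrable V) {u : E}
    (hfu : F.sact f u = 0) (hVu : F.sact V u = u) {c : ℂ}
    (hlt : ∫⁻ t, ‖scalarConv f V t - c * V t‖ₑ < ‖c‖ₑ) : u = 0 := by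
  have hfV := integrable_scalarConv hf hV
  have hact : F.sact (scalarConv f V - c • V) u = -(c • u) := by
    rw [F.sact_sub_left hfV (hV.smul c), ← F.sact_sact hf hV,
      F.sact_const_smul hV, hVu, hfu, zero_sub]
  have hle : ‖c‖ₑ * ‖u‖ₑ ≤ (∫⁻ t, ‖scalarConv f V t - c * V t‖ₑ) * ‖u‖ₑ := by
    rw [← enorm_smul, ← enorm_neg, ← hact]
    exact F.enorm_sact_le (hfV.sub (hV.smul c)) u
  by_contra hu
  exact (ENNReal.mul_lt_mul_left (enorm_ne_zero.2 hu) enorm_ne_top hlt).not_ge hle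

theorem exists_spectrumVanishesOn_of_notMem {l₀ : ℝ} (hl₀ : l₀ ∉ F.beurlingSpectrum x) :
    ∃ U : Set ℝ, IsOpen U ∧ l₀ ∈ U ∧ F.SpectrumVanishesOn x U := by
  obtain ⟨f, hf, hfl₀, hfx⟩ := Set.notMem_compl_iff.1 hl₀
  rw [← F.sact_eq_zero_iff hf] at hfx
  obtain ⟨V, hV, hV_one, hlt⟩ :=
    exists_integrable_scalarFourier_eq_one hf l₀ (enorm_ne_zero.2 hfl₀)
  obtain ⟨U, hU_one, hU, hl₀U⟩ := eventually_nhds_iff.1 hV_one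
  refine ⟨U, hU, hl₀U, fun χ hχ hχU => ?_⟩
  set g := fourierSynthesis χ
  have hg : Integrable g := hχ.integrable_fourierSynthesis
  have hVχ : scalarFourier V * χ = χ := by
    ext l
    by_cases hl : l ∈ tsupport χ
    · rw [Pi.mul_apply, hU_one l (hχU hl), one_mul]
    · rw [Pi.mul_apply, image_eq_zero_of_notMem_tsupport hl, mul_zero]
  have hVg : scalarConv V g = g := by
    rw [scalarConv_fourierSynthesis hV hχ.integrable, hVχ]
  refine eq_zero_of_sact_eq_self (F := F) hf hV ?_ ?_ hlt
  · rw [F.sact_sact_comm hf hg, hfx, F.sact_zero hg]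
  · rw [F.sact_sact hV hg, hVg]

theorem sact_fourierSynthesis_eq_zero {χ : ℝ → ℂ} (hχ : IsTestFunction χ)
    (hd : Disjoint (tsupport χ) (F.beurlingSpectrum x)) : F.sact (fourierSynthesis χ) x = 0 := by
  obtain ⟨U, -, hχU, hxU⟩ : ∃ U, IsOpen U ∧ tsupport χ ⊆ U ∧ F.SpectrumVanishesOn x U := by
    refine hχ.hasCompactSupport.isCompact.induction_on
      ⟨∅, isOpen_empty, le_rfl, F.spectrumVanishesOn_empty x⟩
      (fun s t hst ⟨U, hU, htU, hxU⟩ => ⟨U, hU, hst.trans htU, hxU⟩) ?_ fun l hl => ?_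
    · rintro s t ⟨U, hU, hsU, hxU⟩ ⟨V, hV, htV, hxV⟩
      exact ⟨U ∪ V, hU.union hV, Set.union_subset_union hsU htV, hxU.union hxV hU hV⟩
    · obtain ⟨U, hU, hlU, hxU⟩ := exists_spectrumVanishesOn_of_notMem (Set.disjoint_left.1 hd hl)
      exact ⟨U, mem_nhdsWithin_of_mem_nhds (hU.mem_nhds hlU), U, hU, le_rfl, hxU⟩
  exact hxU χ hχ hχU

theorem SpectrumVanishesOn.eq_zero_of_univ (h : F.SpectrumVanishesOn x Set.univ) : x = 0 := by
  obtain ⟨χ, hχ, -, V, -, h0V, hχV⟩ := exists_isTestFunction_eq_one_nhds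
    (isCompact_singleton (x := (0 : ℝ))) isOpen_univ (Set.subset_univ _)
  refine F.nondegenerate x fun f hf => (F.sact_eq_zero_iff hf x).1 ?_
  have hlim : Tendsto (fun ε : ℝ => (∫⁻ t,
      ‖scalarConv (fourierSynthesis fun l => χ (ε * l)) f t - f t‖ₑ) * ‖x‖ₑ) (𝓝[>] 0) (𝓝 0) := by
    simpa only [zero_mul] using ENNReal.Tendsto.mul_const
      (hχ.tendsto_lintegral_scalarConv_sub (hχV 0 (h0V rfl)) hf) (Or.inr enorm_ne_top)
  refine enorm_eq_zero.1 (nonpos_iff_eq_zero.1 (ge_of_tendsto hlim ?_))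
  filter_upwards [self_mem_nhdsWithin] with ε hε
  have hχε : IsTestFunction fun l => χ (ε * l) := hχ.comp_mul_left (Set.mem_Ioi.1 hε).ne'
  set k := fourierSynthesis fun l => χ (ε * l)
  have hk : Integrable k := hχε.integrable_fourierSynthesis
  have hkf : F.sact (scalarConv k f) x = 0 := by
    rw [← F.sact_sact hk hf, F.sact_sact_comm hk hf, h _ hχε (Set.subset_univ _), F.sact_zero hf]
  have hsub : F.sact (scalarConv k f - f) x = -F.sact f x := by
    rw [F.sact_sub_left (integrable_scalarConv hk hf) hf, hkf, zero_sub]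
  rw [← enorm_neg, ← hsub]
  exact F.enorm_sact_le ((integrable_scalarConv hk hf).sub hf) x

theorem sact_fourierSynthesis_eq_self {φ : ℝ → ℂ} (hφ : IsTestFunction φ) {U : Set ℝ}
    (hU : IsOpen U) (hxU : F.beurlingSpectrum x ⊆ U) (h1 : ∀ l ∈ U, φ l = 1) :
    F.sact (fourierSynthesis φ) x = x := by
  refine (sub_eq_zero.1 (SpectrumVanishesOn.eq_zero_of_univ (F := F) fun χ hχ _ => ?_)).symm
  rw [F.sact_sub hχ.integrable_fourierSynthesis,
    F.sact_fourierSynthesis_sact hχ hφ, ← F.sact_fourierSynthesis_sub hχ (hχ.mul hφ)]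
  refine sact_fourierSynthesis_eq_zero (hχ.sub (hχ.mul hφ)) (Set.disjoint_left.2 fun l hl hlx => ?_)
  exact (tsupport_sub_mul_subset_diff hU h1 hl).2 (hxU hlx)

end HomogeneousSpace

section MildSolutionConvolution

variable {X : Type*} [NormedAddCommGroup X] [NormedSpace ℂ X]

theorem IsStepanov.integrable_prod_apply_comp_sub {y : ℝ → X} (hy : IsStepanov y)
    {K : ℝ → X →L[ℂ] X} (hK : Integrable K) (s t : ℝ) :
    Integrable (fun p : ℝ × ℝ => K p.2 (y (p.1 - p.2)))
      ((volume.restrict (Set.Ioc s t)).prod volume) := by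
  have hmeas : AEStronglyMeasurable (fun p : ℝ × ℝ => K p.2 (y (p.1 - p.2)))
      ((volume.restrict (Set.Ioc s t)).prod volume) :=
    (ContinuousLinearMap.id ℂ _).aestronglyMeasurable_comp₂ hK.1.comp_snd
      ((hy.aestronglyMeasurable.comp_quasiMeasurePreserving
        (quasiMeasurePreserving_sub volume volume)).mono_ac
        (Measure.absolutelyContinuous_restrict.prod Measure.AbsolutelyContinuous.rfl))
  refine ⟨hmeas, ?_⟩
  rw [HasFiniteIntegral, lintegral_prod _ hmeas.enorm]
  calc ∫⁻ τ in Set.Ioc s t, ∫⁻ r, ‖K r (y (τ - r))‖ₑ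
      ≤ ∫⁻ τ in Set.Icc s t, ‖∫⁻ r, ‖K r‖ₑ * ‖y (τ - r)‖ₑ‖ₑ :=
        (lintegral_mono_set Set.Ioc_subset_Icc_self).trans
          (lintegral_mono fun τ => lintegral_mono fun r => (K r).le_opENorm _)
    _ < ⊤ := ((hy.lintegral_mul_comp_sub hK.1.enorm hK.2.ne).setLIntegral_Icc_ne_top s t).lt_top

namespace C0Semigroup.IsMildSolution

variable [CompleteSpace X] {T : C0Semigroup X} {u y : ℝ → X}

theorem exists_enorm_le_setLIntegral (h : T.IsMildSolution u y) :
    ∃ M : ℝ≥0∞, M ≠ ⊤ ∧ ∀ t,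
      ‖u t‖ₑ ≤ M * ((∫⁻ s in Set.Icc (t - 1) t, ‖u s‖ₑ) + ∫⁻ τ in Set.Icc (t - 1) t, ‖y τ‖ₑ) := by
  obtain ⟨M, hM, hT⟩ := T.exists_enorm_op_le 1
  refine ⟨M, hM, fun t => ?_⟩
  have hle : ∀ s ∈ Set.Icc (t - 1) t,
      ‖u t‖ₑ ≤ M * (‖u s‖ₑ + ∫⁻ τ in Set.Icc (t - 1) t, ‖y τ‖ₑ) := fun s hs => by
    rw [h s t hs.2, mul_add, intervalIntegral.integral_of_le hs.2]
    refine enorm_sub_le.trans (add_le_add (hT _ (by linarith [hs.1]) _) ?_)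
    calc ‖∫ τ in Set.Ioc s t, T.op (t - τ).toNNReal (y τ)‖ₑ
        ≤ ∫⁻ τ in Set.Ioc s t, ‖T.op (t - τ).toNNReal (y τ)‖ₑ :=
          enorm_integral_le_lintegral_enorm _
      _ ≤ ∫⁻ τ in Set.Ioc s t, M * ‖y τ‖ₑ := setLIntegral_mono' measurableSet_Ioc
          fun τ hτ => hT _ (by linarith [hτ.1, hs.1]) _
      _ ≤ ∫⁻ τ in Set.Icc (t - 1) t, M * ‖y τ‖ₑ := lintegral_mono_set
          (Set.Ioc_subset_Icc_self.trans (Set.Icc_subset_Icc_left hs.1))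
      _ = M * ∫⁻ τ in Set.Icc (t - 1) t, ‖y τ‖ₑ := lintegral_const_mul' _ _ hM
  calc ‖u t‖ₑ = ∫⁻ _ in Set.Icc (t - 1) t, ‖u t‖ₑ := by simp
    _ ≤ ∫⁻ s in Set.Icc (t - 1) t, M * (‖u s‖ₑ + ∫⁻ τ in Set.Icc (t - 1) t, ‖y τ‖ₑ) :=
        setLIntegral_mono' measurableSet_Icc hle
    _ = M * ((∫⁻ s in Set.Icc (t - 1) t, ‖u s‖ₑ) + ∫⁻ τ in Set.Icc (t - 1) t, ‖y τ‖ₑ) := by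
        rw [lintegral_const_mul' _ _ hM, lintegral_add_right _ measurable_const,
          setLIntegral_const]
        simp

theorem exists_enorm_le (h : T.IsMildSolution u y) (hu : IsStepanov u) (hy : IsStepanov y) :
    ∃ C : ℝ≥0∞, C ≠ ⊤ ∧ ∀ t, ‖u t‖ₑ ≤ C := by
  obtain ⟨M, hM, hle⟩ := h.exists_enorm_le_setLIntegral
  obtain ⟨Cu, hCu, hu_le⟩ := hu.exists_setLIntegral_Icc_le
  obtain ⟨Cy, hCy, hy_le⟩ := hy.exists_setLIntegral_Icc_le
  exact ⟨M * (Cu + Cy), by finiteness, fun t => (hle t).trans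
    (mul_le_mul_right (add_le_add (hu_le t) (hy_le t)) _)⟩

theorem integrable_apply_comp_sub (h : T.IsMildSolution u y) (hu : IsStepanov u)
    (hy : IsStepanov y) {K : ℝ → X →L[ℂ] X} (hK : Integrable K) (t : ℝ) :
    Integrable fun s => K s (u (t - s)) := by
  obtain ⟨C, hC, hle⟩ := h.exists_enorm_le hu hy
  refine hu.integrable_opConv_of_lintegral hK.1 ?_
  calc ∫⁻ s, ‖K s‖ₑ * ‖u (t - s)‖ₑ
      ≤ ∫⁻ s, ‖K s‖ₑ * C := lintegral_mono fun s => mul_le_mul_right (hle _) _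
    _ = (∫⁻ s, ‖K s‖ₑ) * C := lintegral_mul_const' _ _ hC
    _ < ⊤ := ENNReal.mul_lt_top hK.2 hC.lt_top

theorem opConv (h : T.IsMildSolution u y) (hu : IsStepanov u) (hy : IsStepanov y)
    {K : ℝ → X →L[ℂ] X} (hK : Integrable K) (hKT : ∀ r a v, K r (T.op a v) = T.op a (K r v)) :
    T.IsMildSolution (opConv K u) (opConv K y) :=
  integral (u := fun r t => K r (u (t - r))) (f := fun r t => K r (y (t - r)))
    (fun r => (h.map hy.locallyIntegrable (hKT r)).comp_sub_right r)
    (h.integrable_apply_comp_sub hu hy hK) (hy.integrable_prod_apply_comp_sub hK)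

theorem opConv_left {K : ℝ → X →L[ℂ] X} {ψ : ℝ → ℂ}
    (hK : ∀ v, T.IsMildSolution (fun t => K t v) fun t => ψ t • v) (hψ : Integrable ψ)
    (hy : IsStepanov y) (hKy : ∀ t, Integrable fun s => K s (y (t - s))) :
    T.IsMildSolution (_root_.opConv K y) (scalarConv ψ y) := by
  have hsuper : T.IsMildSolution (fun t => ∫ r, K (t - r) (y r))
      fun t => ∫ r, ψ (t - r) • y r := by
    refine integral (fun r => (hK (y r)).comp_sub_right r) (fun t => ?_) fun s t => ?_
    · simpa only [sub_sub_cancel] using (hKy t).comp_sub_left t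
    · have hskew : MeasurePreserving (fun p : ℝ × ℝ => (p.1, p.1 - p.2))
          ((volume.restrict (Set.Ioc s t)).prod volume)
          ((volume.restrict (Set.Ioc s t)).prod volume) :=
        (MeasurePreserving.id _).skew_product (by fun_prop)
          (ae_of_all _ fun τ => (Measure.measurePreserving_sub_left volume τ).map_eq)
      simpa [Function.comp_def] using hskew.integrable_comp_of_integrable
        (hy.integrable_prod_apply_comp_sub (hψ.smul_const (1 : X →L[ℂ] X)) s t)
  convert hsuper using 2 with t t
  · rw [_root_.opConv, ← integral_sub_left_eq_self _ volume t]
    simp only [sub_sub_cancel]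
  · rw [scalarConv, ← integral_sub_left_eq_self _ volume t]
    simp only [sub_sub_cancel]

theorem fourierSynthesis {Φ Ψ : ℝ → X} (hΦ : Integrable Φ) (hΨ : Integrable Ψ)
    (h : ∀ l : ℝ, T.IsMildSolution (fun t => Complex.exp (Complex.I * l * t) • Φ l)
      fun t => Complex.exp (Complex.I * l * t) • Ψ l) :
    T.IsMildSolution (fourierSynthesis Φ) (fourierSynthesis Ψ) := by
  refine (integral h (fun t => integrable_exp_smul hΦ t) fun s t => ?_).const_smul _
  refine (hΨ.comp_snd _).mono (AEStronglyMeasurable.smul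
    (Continuous.aestronglyMeasurable (by fun_prop)) hΨ.1.comp_snd) (ae_of_all _ fun p => ?_)
  rw [norm_smul, norm_exp_I_mul, one_mul]

end C0Semigroup.IsMildSolution

end MildSolutionConvolution

theorem map_fourierSynthesis {Y Z : Type*} [NormedAddCommGroup Y] [NormedSpace ℂ Y]
    [CompleteSpace Y] [NormedAddCommGroup Z] [NormedSpace ℂ Z] [CompleteSpace Z] (L : Y →L[ℂ] Z)
    {Φ : ℝ → Y} (hΦ : Integrable Φ) (t : ℝ) :
    L (fourierSynthesis Φ t) = fourierSynthesis (fun l => L (Φ l)) t := by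
  rw [fourierSynthesis, fourierSynthesis, map_smul,
    ← L.integral_comp_comm (integrable_exp_smul hΦ t)]
  simp only [map_smul]

section ResolventKernel

variable {X : Type*} [NormedAddCommGroup X] [NormedSpace ℂ X]

theorem resolventKernel_eq_fourierSynthesis (A : X →ₗ.[ℂ] X) (φ : ℝ → ℂ) :
    resolventKernel A φ =
      fourierSynthesis fun l : ℝ => φ l • unboundedResolvent A (Complex.I * l) := by
  ext1 t
  simp only [resolventKernel, fourierSynthesis, smul_smul, mul_comm (φ _)]

namespace IsSpectralCutoff

variable {A : X →ₗ.[ℂ] X} {Δ : Set ℝ} {φ : ℝ → ℂ}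

theorem isTestFunction (hφ : IsSpectralCutoff A Δ φ) : IsTestFunction φ :=
  ⟨hφ.smooth, hφ.compact_support⟩

variable [CompleteSpace X]

theorem contDiff_smul_resolvent (hφ : IsSpectralCutoff A Δ φ) :
    ContDiff ℝ ∞ fun l : ℝ => φ l • unboundedResolvent A (Complex.I * l) := by
  refine contDiff_iff_contDiffAt.2 fun l => ?_
  by_cases hl : l ∈ tsupport φ
  · have hline : ContDiffAt ℝ ∞ (fun l : ℝ => Complex.I * (l : ℂ)) l :=
      (contDiff_const.mul Complex.ofRealCLM.contDiff).contDiffAt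
    exact hφ.smooth.contDiffAt.smul (ContDiffAt.comp l (g := fun w => unboundedResolvent A w)
      ((contDiffAt_unboundedResolvent (hφ.support_resolvent l hl)).restrict_scalars ℝ) hline)
  · refine (contDiffAt_const (c := (0 : X →L[ℂ] X))).congr_of_eventuallyEq ?_
    filter_upwards [(isClosed_tsupport φ).isOpen_compl.mem_nhds hl] with r hr
    rw [image_eq_zero_of_notMem_tsupport hr, zero_smul]

theorem isTestFunction_smul_resolvent (hφ : IsSpectralCutoff A Δ φ) :
    IsTestFunction fun l : ℝ => φ l • unboundedResolvent A (Complex.I * l) :=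
  ⟨hφ.contDiff_smul_resolvent, hφ.compact_support.smul_right⟩

theorem integrable_resolventKernel (hφ : IsSpectralCutoff A Δ φ) :
    Integrable (resolventKernel A φ) := by
  rw [resolventKernel_eq_fourierSynthesis]
  exact hφ.isTestFunction_smul_resolvent.integrable_fourierSynthesis

theorem resolventKernel_apply (hφ : IsSpectralCutoff A Δ φ) (t : ℝ) (v : X) :
    resolventKernel A φ t v =
      fourierSynthesis (fun l => φ l • unboundedResolvent A (Complex.I * l) v) t := by
  rw [resolventKernel_eq_fourierSynthesis]
  exact map_fourierSynthesis (ContinuousLinearMap.apply ℂ X v)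
    hφ.isTestFunction_smul_resolvent.integrable t

theorem integrable_smul_resolvent_apply (hφ : IsSpectralCutoff A Δ φ) (v : X) :
    Integrable fun l : ℝ => φ l • unboundedResolvent A (Complex.I * l) v :=
  hφ.isTestFunction_smul_resolvent.integrable.apply_continuousLinearMap v

variable {T : C0Semigroup X}

theorem resolventKernel_map_op (hφ : IsSpectralCutoff T.generator Δ φ) (t : ℝ) (a : ℝ≥0)
    (v : X) : resolventKernel T.generator φ t (T.op a v) =
      T.op a (resolventKernel T.generator φ t v) := by
  rw [hφ.resolventKernel_apply, hφ.resolventKernel_apply,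
    map_fourierSynthesis _ (hφ.integrable_smul_resolvent_apply v)]
  congr 1 with l
  by_cases hl : l ∈ tsupport φ
  · rw [map_smul, (isResolventAt_unboundedResolvent (hφ.support_resolvent l hl)).map_op]
  · simp [image_eq_zero_of_notMem_tsupport hl]

theorem isMildSolution_resolventKernel_apply (hφ : IsSpectralCutoff T.generator Δ φ) (v : X) :
    T.IsMildSolution (fun t => resolventKernel T.generator φ t v)
      fun t => fourierSynthesis φ t • v := by
  have hφ_int := hφ.isTestFunction.integrable
  have hsmul (t : ℝ) : fourierSynthesis φ t • v = fourierSynthesis (fun l => φ l • v) t :=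
    map_fourierSynthesis ((ContinuousLinearMap.id ℂ ℂ).smulRight v) hφ_int t
  simp only [hφ.resolventKernel_apply, hsmul]
  refine .fourierSynthesis (hφ.integrable_smul_resolvent_apply v) (hφ_int.smul_const v) fun l => ?_
  by_cases hl : l ∈ tsupport φ
  · simpa only [smul_comm (φ l)] using ((isResolventAt_unboundedResolvent
      (hφ.support_resolvent l hl)).isMildSolution_exp_smul v).const_smul (φ l)
  · simp only [image_eq_zero_of_notMem_tsupport hl, zero_smul, smul_zero]
    exact C0Semigroup.IsMildSolution.zero

theorem isMildSolution_opConv_resolventKernel (hφ : IsSpectralCutoff T.generator Δ φ)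
    {y : ℝ → X} (hy : IsStepanov y) :
    T.IsMildSolution (opConv (resolventKernel T.generator φ) y)
      (scalarConv (fourierSynthesis φ) y) := by
  obtain ⟨C, hC⟩ := hφ.isTestFunction_smul_resolvent.exists_norm_fourierSynthesis_le
  rw [← resolventKernel_eq_fourierSynthesis] at hC
  exact .opConv_left hφ.isMildSolution_resolventKernel_apply
    hφ.isTestFunction.integrable_fourierSynthesis hy
    (hy.integrable_opConv_of_decay hφ.integrable_resolventKernel.1 hC)

end IsSpectralCutoff

theorem exists_isSpectralCutoff [CompleteSpace X] (A : X →ₗ.[ℂ] X) {Δ : Set ℝ} (hΔ : IsCompact Δ)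
    (hA : ((fun l : ℝ => Complex.I * (l : ℂ)) '' Δ) ∩ unboundedSpectrum A = ∅) :
    ∃ φ : ℝ → ℂ, IsSpectralCutoff A Δ φ := by
  have hopen : IsOpen {l : ℝ | Complex.I * (l : ℂ) ∈ unboundedResolventSet A} :=
    (isOpen_unboundedResolventSet A).preimage (by fun_prop)
  have hsub : Δ ⊆ {l : ℝ | Complex.I * (l : ℂ) ∈ unboundedResolventSet A} := fun l hl =>
    by_contra fun hn => (Set.eq_empty_iff_forall_notMem.1 hA) _ ⟨⟨l, hl, rfl⟩, hn⟩
  obtain ⟨φ, hφ, hφU, hφ_one⟩ := exists_isTestFunction_eq_one_nhds hΔ hopen hsub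
  exact ⟨φ, hφ.smooth, hφ.hasCompactSupport, hφ_one, fun l hl => hφU hl⟩

end ResolventKernel

namespace HomogeneousSpace

variable {X E : Type*} [NormedAddCommGroup X] [NormedSpace ℂ X]
  [NormedAddCommGroup E] [NormedSpace ℂ E] {F : HomogeneousSpace X E} {T : C0Semigroup X}
  {x y y' : E} {Δ : Set ℝ} {φ : ℝ → ℂ}

theorem zero_mem_spectralSubmodule (F : HomogeneousSpace X E) (Δ : Set ℝ) :
    (0 : E) ∈ F.spectralSubmodule Δ := by
  intro l hl
  obtain ⟨φ, hφ, -, V, -, hlV, hφV⟩ := exists_isTestFunction_eq_one_nhds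
    (isCompact_singleton (x := l)) isOpen_univ (Set.subset_univ _)
  have hφ_int := hφ.integrable_fourierSynthesis
  refine absurd ⟨_, hφ_int, ?_, (F.sact_eq_zero_iff hφ_int 0).1 (F.sact_zero hφ_int)⟩ hl
  rw [hφ.scalarFourier_fourierSynthesis, hφV l (hlV rfl)]
  exact one_ne_zero

theorem ParabolicGraph.zero (F : HomogeneousSpace X E) (T : C0Semigroup X) :
    F.ParabolicGraph T 0 0 :=
  ⟨0, F.toAE_zero_ae.symm, C0Semigroup.IsMildSolution.zero.congr_ae F.toAE_zero_ae.symm⟩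

variable [CompleteSpace X]

theorem ParabolicGraph.unique (h : F.ParabolicGraph T x y) (h' : F.ParabolicGraph T x y') :
    y = y' := by
  obtain ⟨u, hu, hmild⟩ := h
  obtain ⟨u', hu', hmild'⟩ := h'
  exact F.ext_ae (C0Semigroup.IsMildSolution.inhomogeneity_unique hmild hmild'
    (EventuallyEq.trans hu (EventuallyEq.symm hu')) (F.isStepanov y).locallyIntegrable
    (F.isStepanov y').locallyIntegrable)

theorem ParabolicGraph.act (h : F.ParabolicGraph T x y) {K : ℝ → X →L[ℂ] X}
    (hK : Integrable K) (hKT : ∀ r a v, K r (T.op a v) = T.op a (K r v)) :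
    F.ParabolicGraph T (F.act K x) (F.act K y) := by
  obtain ⟨u, hu, hmild⟩ := h
  refine ⟨opConv K u, ?_, (C0Semigroup.IsMildSolution.opConv hmild
    ((F.isStepanov x).congr_ae (EventuallyEq.symm hu)) (F.isStepanov y) hK hKT).congr_ae
      (F.toAE_act hK y).symm⟩
  rw [opConv_congr_ae hu]
  exact (F.toAE_act hK x).symm

theorem ParabolicGraph.sact (h : F.ParabolicGraph T x y) {f : ℝ → ℂ} (hf : Integrable f) :
    F.ParabolicGraph T (F.sact f x) (F.sact f y) :=
  h.act (hf.smul_const (1 : X →L[ℂ] X)) fun r a v => by simp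

theorem ParabolicGraph.beurlingSpectrum_subset (h : F.ParabolicGraph T x y) :
    F.beurlingSpectrum y ⊆ F.beurlingSpectrum x :=
  F.beurlingSpectrum_subset_of_sact fun f hf hfx => by
    have hfxy := h.sact hf
    rw [hfx] at hfxy
    exact hfxy.unique (.zero F T)

theorem ParabolicGraph.mem_spectralSubmodule (h : F.ParabolicGraph T x y)
    (hx : x ∈ F.spectralSubmodule Δ) : y ∈ F.spectralSubmodule Δ :=
  h.beurlingSpectrum_subset.trans hx

theorem act_mem_spectralSubmodule {K : ℝ → X →L[ℂ] X} (hK : Integrable K)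
    (hx : x ∈ F.spectralSubmodule Δ) : F.act K x ∈ F.spectralSubmodule Δ :=
  (F.beurlingSpectrum_subset_of_sact fun f hf hfx => by
    rw [F.sact_act_comm hf hK, hfx, F.act_zero hK]).trans hx

theorem sact_fourierSynthesis_eq_self_of_mem {A : X →ₗ.[ℂ] X} (hφ : IsSpectralCutoff A Δ φ)
    (hx : x ∈ F.spectralSubmodule Δ) : F.sact (fourierSynthesis φ) x = x := by
  obtain ⟨U, hU, hΔU, hφU⟩ := hφ.eq_one
  exact sact_fourierSynthesis_eq_self hφ.isTestFunction hU (Set.Subset.trans hx hΔU) hφU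

theorem parabolicGraph_act_resolventKernel (hφ : IsSpectralCutoff T.generator Δ φ)
    (hy : y ∈ F.spectralSubmodule Δ) :
    F.ParabolicGraph T (F.act (resolventKernel T.generator φ) y) y := by
  refine ⟨_, (F.toAE_act hφ.integrable_resolventKernel y).symm,
    (hφ.isMildSolution_opConv_resolventKernel (F.isStepanov y)).congr_ae ?_⟩
  have hψ := F.toAE_sact hφ.isTestFunction.integrable_fourierSynthesis y
  rw [sact_fourierSynthesis_eq_self_of_mem hφ hy] at hψ
  exact hψ.symm

theorem parabolicGraphIn_act_resolventKernel (hφ : IsSpectralCutoff T.generator Δ φ)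
    (hy : y ∈ F.spectralSubmodule Δ) :
    F.ParabolicGraphIn T (F.spectralSubmodule Δ) (F.act (resolventKernel T.generator φ) y) y :=
  ⟨act_mem_spectralSubmodule hφ.integrable_resolventKernel hy, hy,
    parabolicGraph_act_resolventKernel hφ hy⟩

theorem ParabolicGraph.eq_zero_of_mem (h : F.ParabolicGraph T x 0)
    (hφ : IsSpectralCutoff T.generator Δ φ) (hx : x ∈ F.spectralSubmodule Δ) : x = 0 := by
  have hact := h.act hφ.integrable_resolventKernel hφ.resolventKernel_map_op
  rw [F.act_zero hφ.integrable_resolventKernel] at hact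
  exact (parabolicGraph_act_resolventKernel hφ hx).unique hact

theorem isInvertibleGraph_parabolicGraphIn (F : HomogeneousSpace X E)
    (hφ : IsSpectralCutoff T.generator Δ φ) :
    IsInvertibleGraph (F.ParabolicGraphIn T (F.spectralSubmodule Δ)) (F.spectralSubmodule Δ) where
  single_valued x y y' h h' := h.2.2.unique h'.2.2
  ker_eq := by
    have h0 := F.zero_mem_spectralSubmodule Δ
    refine Set.Subset.antisymm (fun x hx => hx.2.2.eq_zero_of_mem hφ hx.1) ?_
    exact Set.singleton_subset_iff.2 ⟨h0, h0, .zero F T⟩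
  range_eq := Set.Subset.antisymm (fun _ ⟨_, h⟩ => h.2.1)
    fun _ hy => ⟨_, parabolicGraphIn_act_resolventKernel hφ hy⟩

end HomogeneousSpace

theorem theorem3p3_general {X E : Type*}
    [NormedAddCommGroup X] [NormedSpace ℂ X] [CompleteSpace X]
    [NormedAddCommGroup E] [NormedSpace ℂ E]
    (F : HomogeneousSpace X E) (T : C0Semigroup X) (Δ : Set ℝ) (hΔ : IsCompact Δ)
    (hA : ((fun l : ℝ => Complex.I * (l : ℂ)) '' Δ) ∩ unboundedSpectrum T.generator = ∅) :
    (∀ x ∈ F.spectralSubmodule Δ, ∀ y, F.ParabolicGraph T x y → y ∈ F.spectralSubmodule Δ) ∧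
    IsInvertibleGraph (F.ParabolicGraphIn T (F.spectralSubmodule Δ)) (F.spectralSubmodule Δ) ∧
    (∃ φ : ℝ → ℂ, IsSpectralCutoff T.generator Δ φ) ∧
    ∀ φ : ℝ → ℂ, IsSpectralCutoff T.generator Δ φ →
      Integrable (resolventKernel T.generator φ) ∧
      ∀ y ∈ F.spectralSubmodule Δ, ∃ x : E,
        (∀ᵐ t : ℝ, F.toAE x t = opConv (resolventKernel T.generator φ) (F.toAE y) t) ∧
        F.ParabolicGraphIn T (F.spectralSubmodule Δ) x y := by
  obtain ⟨φ₀, hφ₀⟩ := exists_isSpectralCutoff T.generator hΔ hA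
  refine ⟨fun x hx y h => h.mem_spectralSubmodule hx, F.isInvertibleGraph_parabolicGraphIn hφ₀,
    ⟨φ₀, hφ₀⟩, fun φ hφ => ?_⟩
  have hK : Integrable (resolventKernel T.generator φ) := hφ.integrable_resolventKernel
  exact ⟨hK, fun y hy => ⟨F.act (resolventKernel T.generator φ) y, F.toAE_act hK y,
    HomogeneousSpace.parabolicGraphIn_act_resolventKernel hφ hy⟩⟩

theorem theorem3p3 {X E : Type*}
    [NormedAddCommGroup X] [NormedSpace ℂ X] [CompleteSpace X]
    [NormedAddCommGroup E] [NormedSpace ℂ E] [CompleteSpace E]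
    (F : HomogeneousSpace X E) (T : C0Semigroup X) (Δ : Set ℝ) (hΔ : IsCompact Δ)
    (hA : ((fun l : ℝ => Complex.I * (l : ℂ)) '' Δ) ∩ unboundedSpectrum T.generator = ∅) :
    (∀ x ∈ F.spectralSubmodule Δ, ∀ y, F.ParabolicGraph T x y → y ∈ F.spectralSubmodule Δ) ∧
    IsInvertibleGraph (F.ParabolicGraphIn T (F.spectralSubmodule Δ)) (F.spectralSubmodule Δ) ∧
    (∃ φ : ℝ → ℂ, IsSpectralCutoff T.generator Δ φ) ∧
    ∀ φ : ℝ → ℂ, IsSpectralCutoff T.generator Δ φ →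
      Integrable (resolventKernel T.generator φ) ∧
      ∀ y ∈ F.spectralSubmodule Δ, ∃ x : E,
        (∀ᵐ t : ℝ, F.toAE x t = opConv (resolventKernel T.generator φ) (F.toAE y) t) ∧
        F.ParabolicGraphIn T (F.spectralSubmodule Δ) x y :=
  theorem3p3_general F T Δ hΔ hA
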